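/- Let $\log$ denote the logarithm to base $2$, and let $\mathcal H_A=\mathbb C^{d_A}$, $\mathcal H_B=\mathbb C^{d_B}$ with $d_A\le d_B$. For a unit vector $\psi\in\mathcal H_A\otimes\mathcal H_B$ let $\rho_A=\mathrm{tr}_B\,|\psi\rangle\langle\psi|$ be its reduced density operator, let $S_{\min}(\rho)=-\log\|\rho\|$ (operator norm), and for $\beta>0$ let $S^{(\beta)}_R(\rho)=\frac{1}{1-\beta}\log\mathrm{tr}\,\rho^\beta$, where $S^{(1)}_R(\rho)=-\mathrm{tr}(\rho\log\rho)$. A projective $t$-design in $\mathbb C^d$ is a Borel probability measure $\nu$ on the unit sphere of $\mathbb C^d$ such that $\mathbb E_\nu\,p(\psi)=\int p(\psi)\,d\psi$ (normalized uniform measure) for every polynomial $p$ that is homogeneous of degree $t$ in the coordinates of $\psi$ and homogeneous of degree $t$ in their complex conjugates. **Theorem 3.** Let $\nu_\alpha$ be a projective $\alpha$-design in $\mathcal H_A\otimes\mathcal H_B$, where $\alpha=\lceil(\log d_A)/a\rceil\le(16d_B^2)^{1/3}$ with $0<a\le1$. Then $$\mathbb E_{\nu_\alpha}S_{\min}(\rho_A)\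 \ge\ \log d_A-2-a .$$ In particular, $\mathbb E_{\nu_\alpha}S_{\min}(\rho_A)\ge\log d_A-3$ if $\alpha=\lceil\log d_A\rceil$. Consequently, the same lower bounds (in both cases) hold for $\mathbb E_{\nu_\alpha}S^{(\beta)}_R(\rho_A)$ for every order $\beta>0$. All these entropies are $\nu_\alpha$-integrable functions of $\psi$. -/

import Mathlib

open MeasureTheory

noncomputable section

/-- The Hilbert space `ℂ^{d_A} ⊗ ℂ^{d_B}`, in coordinates with respect to the product basis. -/
abbrev BipartiteSpace (dA dB : ℕ) : Type := EuclideanSpace ℂ (Fin dA × Fin dB)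

/-- Pure state vectors, i.e. unit vectors of the space `ℂ^ι`. -/
abbrev PureState (ι : Type) [Fintype ι] : Type := Metric.sphere (0 : EuclideanSpace ℂ ι) 1

/-- The normalized uniform measure on the complex unit sphere of `ℂ^ι`: the surface measure
induced by Lebesgue measure, divided by its total mass. -/
def uniformMeasure (ι : Type) [Fintype ι] : Measure (PureState ι) :=
  ((volume : Measure (EuclideanSpace ℂ ι)).toSphere Set.univ)⁻¹ •
    (volume : Measure (EuclideanSpace ℂ ι)).toSphere

/-- `p` is homogeneous of degree `t` in the coordinates (the variables `Sum.inl i`) and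
homogeneous of degree `t` in their complex conjugates (the variables `Sum.inr i`). -/
def IsBihomogeneous {ι : Type} (t : ℕ) (p : MvPolynomial (ι ⊕ ι) ℂ) : Prop :=
  p.IsWeightedHomogeneous (Sum.elim (fun _ => 1) (fun _ => 0) : ι ⊕ ι → ℕ) t ∧
    p.IsWeightedHomogeneous (Sum.elim (fun _ => 0) (fun _ => 1) : ι ⊕ ι → ℕ) t

/-- The value of a polynomial in the coordinates of a vector and their complex conjugates. -/
def evalState {ι : Type} [Fintype ι] (p : MvPolynomial (ι ⊕ ι) ℂ) (ψ : EuclideanSpace ℂ ι) : ℂ :=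
  MvPolynomial.eval (Sum.elim (fun i => ψ i) (fun i => star (ψ i))) p

/-- A (complex projective) `t`-design: an ensemble of pure state vectors, i.e. a probability
measure on the unit sphere, whose averages of all polynomials that are homogeneous of degree `t`
both in the coordinates and in their conjugates agree with the uniform averages. -/
def IsProjectiveDesign {ι : Type} [Fintype ι] (t : ℕ) (ν : Measure (PureState ι)) : Prop :=
  IsProbabilityMeasure ν ∧
    ∀ p : MvPolynomial (ι ⊕ ι) ℂ, IsBihomogeneous t p →
      ∫ ψ, evalState p ψ.1 ∂ν = ∫ ψ, evalState p ψ.1 ∂(uniformMeasure ι)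

/-- The rank-one operator `|ψ⟩⟨ψ|` as a matrix. -/
def ketBra {ι : Type} [Fintype ι] (ψ : EuclideanSpace ℂ ι) : Matrix ι ι ℂ :=
  Matrix.of fun i j => ψ i * star (ψ j)

/-- The partial trace over the second tensor factor. -/
def partialTraceB {dA dB : ℕ} (M : Matrix (Fin dA × Fin dB) (Fin dA × Fin dB) ℂ) :
    Matrix (Fin dA) (Fin dA) ℂ :=
  Matrix.of fun i j => ∑ k : Fin dB, M (i, k) (j, k)

/-- The reduced density operator `ρ_A = tr_B |ψ⟩⟨ψ|`. -/
def reducedDensity {dA dB : ℕ} (ψ : BipartiteSpace dA dB) : Matrix (Fin dA) (Fin dA) ℂ :=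
  partialTraceB (ketBra ψ)

/-- The min entropy `-log₂ ‖ρ‖`, with the operator norm on the Euclidean space `ℂ^n`. -/
def minEntropy {n : ℕ} (ρ : Matrix (Fin n) (Fin n) ℂ) : ℝ :=
  -Real.logb 2 ‖Matrix.toEuclideanCLM (n := Fin n) (𝕜 := ℂ) ρ‖

/-- The Rényi entropy of order `β > 0` of a density matrix, `log₂ (tr ρ^β) / (1 - β)`; at `β = 1`
its limit, the von Neumann entropy `-tr (ρ log₂ ρ)`. Powers and logarithms of the Hermitian
matrix `ρ` are those of the functional calculus (with `0 log 0 = 0`). -/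
def renyiEntropy {n : ℕ} (β : ℝ) (ρ : Matrix (Fin n) (Fin n) ℂ) : ℝ :=
  if β = 1 then -(cfc (fun x : ℝ => x * Real.logb 2 x) ρ).trace.re
  else 1 / (1 - β) * Real.logb 2 (cfc (fun x : ℝ => x ^ β) ρ).trace.re

end

/-! Since `‖ρ‖ ^ k ≤ tr ρ ^ k`, the min entropy is at least `-(1/k) log tr ρ ^ k`. By concavity of
the logarithm it is enough to bound the mean of `tr ρ_A ^ k` for `k = α`, and this function is a
polynomial that an `α`-design averages exactly. A mean of at most `4 ^ k * dA / dA ^ k` gives `log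
dA - 2 - (log dA) / k`, and `(log dA) / k ≤ a`. Rényi entropies of every positive order dominate the
min entropy.

The uniform mean comes from Wick's formula (`integral_uniformMeasure_wick`). With `c` counting
cycles and `τ` a `k`-cycle, it equals `∑ σ, dB ^ c(σ) * dA ^ c(τσ)` divided by the rising factorial
of `dA * dB`, which is at least `(dA * dB) ^ k`. Each term has at least one factor `dA`, so
replacing `dA` by `n = dB` costs a factor of at least `n / dA`. This leaves the square case `dA = dB
= n` (`colouringConv_longCycle_le`).

There the permutation sum is evaluated exactly. The indicator of long cycles is an alternating sum,
over subsets `S`, of the sign of the restriction to `S` (`sum_powerset_restrictSign`). Summed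
against each such sign, the convolution of two class functions collapses, because sign-equivariance
kills all but two kinds of double cosets of `Perm S × Perm Sᶜ` (`sum_block_mul_colouringCount`). The
outcome telescopes to `hookSum n k / k`. The three-term recurrence of `hookSum` then gives `hookSum
n k ≤ k * 4 ^ k * n ^ (k + 1)` as long as `k ^ 3 ≤ 16 * n ^ 2`, the range in which the non-planar
term is harmless. -/

open Equiv

/-! ### Hook sums: recurrence and growth -/

/-- The alternating sum over the hooks of size `k` that gives `k` times the `k`-th trace moment of
a square complex Wishart matrix of size `x`. -/
noncomputable def hookSum (x : ℝ) (k : ℕ) : ℝ :=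
  ∑ b ∈ Finset.range k, (-1) ^ b / ((b.factorial : ℝ) * ((k - 1 - b).factorial : ℝ)) *
    ((ascPochhammer ℝ k).eval (x - b)) ^ 2

lemma ascPochhammer_eval_succ_right (x : ℝ) (k : ℕ) :
    (ascPochhammer ℝ (k + 1)).eval x = (ascPochhammer ℝ k).eval x * (x + k) := by
  simp [ascPochhammer_succ_right]

lemma ascPochhammer_eval_succ_left (x : ℝ) (k : ℕ) :
    (ascPochhammer ℝ (k + 1)).eval x = x * (ascPochhammer ℝ k).eval (x + 1) := by
  simp [ascPochhammer_succ_left, Polynomial.eval_comp]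

/-- The three-term recurrence of Haagerup and Thorbjørnsen in the square case. -/
lemma hookSum_recurrence (x : ℝ) (r : ℕ) :
    ((r : ℝ) + 3) / (r + 2) * hookSum x (r + 2) =
      2 * (2 * r + 3) * x / (r + 1) * hookSum x (r + 1) + (r + 1) ^ 2 * hookSum x r := by
  set w : ℕ → ℝ := fun b => (-1) ^ b / ((b.factorial : ℝ) * ((r + 1 - b).factorial : ℝ)) with hw
  set U : ℕ → ℝ := fun b => (ascPochhammer ℝ r).eval (x - b) with hU
  -- `q` is the rational part of a Zeilberger certificate: the summand of the recurrence is the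
  -- difference of `G`.
  set q : ℝ → ℝ := fun b => (-(r + 3) * x ^ 2 - 2 * (r + 1) * x + (r + 1) ^ 2 * (2 * r + 3) +
    (2 * x - 3 * (r + 1) ^ 2 - (r + 1)) * b + (r + 1) * b ^ 2) / ((r + 1) * (r + 2)) with hq
  set G : ℕ → ℝ := fun b => w b * b * (U b * (x - b + r)) ^ 2 * q b with hG
  have h2 : hookSum x (r + 2) = ∑ b ∈ Finset.range (r + 2),
      w b * (U b * (x - b + r) * (x - b + (r + 1))) ^ 2 := by
    refine Finset.sum_congr rfl fun b _ => ?_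
    rw [ascPochhammer_eval_succ_right, ascPochhammer_eval_succ_right]
    simp only [hw, hU]
    push_cast
    rfl
  have hfac : ∀ b, b ≤ r → ((r + 1 - b).factorial : ℝ) = (r + 1 - b) * ((r - b).factorial : ℝ) := by
    intro b hb
    rw [show r + 1 - b = (r - b) + 1 by omega, Nat.factorial_succ]
    push_cast [Nat.cast_sub hb]
    ring
  have h1 : hookSum x (r + 1) = ∑ b ∈ Finset.range (r + 1),
      w b * (r + 1 - b) * (U b * (x - b + r)) ^ 2 := by
    refine Finset.sum_congr rfl fun b hb => ?_
    have hb' : b ≤ r := by simpa [Nat.lt_succ_iff] using hb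
    have hbr : (b : ℝ) ≤ r := by exact_mod_cast hb'
    rw [ascPochhammer_eval_succ_right]
    simp only [hw, hU, Nat.add_sub_cancel]
    rw [hfac b hb']
    have : ((r : ℝ) + 1 - b) ≠ 0 := by linarith
    have h3 := Nat.factorial_ne_zero b
    have h4 := Nat.factorial_ne_zero (r - b)
    field_simp
  -- The range is extended by `b = r`, where the factor `r - b` vanishes, so that all three sums
  -- share a range.
  have h0 : hookSum x r = ∑ b ∈ Finset.range (r + 1), w b * ((r + 1 - b) * (r - b)) * (U b) ^ 2 := by
    rw [Finset.sum_range_succ]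
    simp only [sub_self, mul_zero, zero_mul, add_zero]
    refine Finset.sum_congr rfl fun b hb => ?_
    have hb' : b < r := by simpa using hb
    have hbr : (b : ℝ) < r := by exact_mod_cast hb'
    simp only [hw, hU]
    rw [hfac b hb'.le, show r - b = (r - 1 - b) + 1 by omega, Nat.factorial_succ]
    have hc : ((r - 1 - b : ℕ) : ℝ) + 1 = r - b := by
      have : (r - 1 - b) + 1 + b = r := by omega
      have h := congrArg (Nat.cast : ℕ → ℝ) this
      push_cast at h
      linarith
    push_cast
    rw [hc]
    have h1 : ((r : ℝ) + 1 - b) ≠ 0 := by linarith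
    have h2 : ((r : ℝ) - b) ≠ 0 := by linarith
    have h3 := Nat.factorial_ne_zero b
    have h4 := Nat.factorial_ne_zero (r - 1 - b)
    field_simp
  have hUU : ∀ b : ℕ, U (b + 1) * (x - (b + 1 : ℕ) + r) = (x - b - 1) * U b := by
    intro b
    simp only [hU]
    rw [← ascPochhammer_eval_succ_right, ascPochhammer_eval_succ_left]
    rw [show x - ((b + 1 : ℕ) : ℝ) + 1 = x - b by push_cast; ring]
    push_cast
    ring
  have hww : ∀ b : ℕ, b ≤ r → w (b + 1) * (b + 1 : ℕ) = - (w b * (r + 1 - b)) := by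
    intro b hb
    have hbr : (b : ℝ) ≤ r := by exact_mod_cast hb
    simp only [hw]
    rw [hfac b hb, show r + 1 - (b + 1) = r - b by omega, Nat.factorial_succ]
    have : ((r : ℝ) + 1 - b) ≠ 0 := by linarith
    have h3 := Nat.factorial_ne_zero b
    have h4 := Nat.factorial_ne_zero (r - b)
    push_cast
    field_simp
    ring
  have hr1 : (r : ℝ) + 1 ≠ 0 := by positivity
  have hr2 : (r : ℝ) + 2 ≠ 0 := by positivity
  have key : ∀ b ∈ Finset.range (r + 1),
      ((r : ℝ) + 3) / (r + 2) * (w b * (U b * (x - b + r) * (x - b + (r + 1))) ^ 2) -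
      2 * (2 * r + 3) * x / (r + 1) * (w b * (r + 1 - b) * (U b * (x - b + r)) ^ 2) -
      (r + 1) ^ 2 * (w b * ((r + 1 - b) * (r - b)) * (U b) ^ 2) = G (b + 1) - G b := by
    intro b hb
    have hb' : b ≤ r := by simpa [Nat.lt_succ_iff] using hb
    simp only [hG]
    rw [hUU, hww b hb']
    simp only [hq]
    push_cast
    field_simp
    ring
  have hsum := Finset.sum_congr rfl key
  rw [Finset.sum_range_sub, Finset.sum_sub_distrib, Finset.sum_sub_distrib, ← Finset.mul_sum,
    ← Finset.mul_sum, ← Finset.mul_sum, ← h1, ← h0] at hsum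
  rw [h2, Finset.sum_range_succ]
  -- Only the order `r + 2` sum has a term `b = r + 1`; it cancels the boundary term of the
  -- telescoping sum.
  have hlast : ((r : ℝ) + 3) / (r + 2) * (w (r + 1) *
      (U (r + 1) * (x - (r + 1 : ℕ) + r) * (x - (r + 1 : ℕ) + (r + 1))) ^ 2) = - G (r + 1) := by
    simp only [hG, hq]
    push_cast
    field_simp
    ring
  have hG0 : G 0 = 0 := by simp [hG]
  rw [hG0] at hsum
  linear_combination hsum + hlast

lemma hookSum_one (x : ℝ) : hookSum x 1 = x ^ 2 := by
  simp [hookSum]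

/-- Both coefficients of the recurrence are nonnegative, so upper bounds propagate through it. The
first term alone would give growth rate `4 * n`; the cubic condition keeps the second within the
slack left by the factor `k`. -/
lemma hookSum_nonneg_le (n : ℕ) (hn : 0 < n) (k : ℕ) (hk : (k : ℝ) ^ 3 ≤ 16 * (n : ℝ) ^ 2) :
    0 ≤ hookSum n k ∧ hookSum n k ≤ k * 4 ^ k * (n : ℝ) ^ (k + 1) := by
  have hn' : (0 : ℝ) < n := by exact_mod_cast hn
  induction k using Nat.strong_induction_on with
  | _ k ih =>
    rcases k with _ | _ | r
    · simp [hookSum]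
    · simp only [zero_add, hookSum_one]
      constructor
      · positivity
      · norm_num
        nlinarith
    · have hmono : ∀ j : ℕ, j ≤ r + 2 → (j : ℝ) ^ 3 ≤ 16 * (n : ℝ) ^ 2 := by
        intro j hj
        refine le_trans ?_ hk
        gcongr
      obtain ⟨a1, b1⟩ := ih (r + 1) (by omega) (hmono _ (by omega))
      obtain ⟨a0, b0⟩ := ih r (by omega) (hmono _ (by omega))
      have hrec := hookSum_recurrence n r
      have hp := hmono (r + 1) (by omega)
      push_cast at hp b1 ⊢
      have hr : (0 : ℝ) ≤ r := by positivity
      have e : hookSum n (r + 2) = (r + 2) / (r + 3) * (2 * (2 * r + 3) * n / (r + 1) *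
          hookSum n (r + 1) + (r + 1) ^ 2 * hookSum n r) := by
        rw [← hrec]
        field_simp
      constructor
      · show 0 ≤ hookSum n (r + 2)
        rw [e]
        positivity
      · show hookSum n (r + 2) ≤ _
        rw [e]
        have s1 : 2 * (2 * r + 3) * n / (r + 1) * hookSum n (r + 1) ≤
            2 * (2 * r + 3) * n / (r + 1) * (((r : ℝ) + 1) * 4 ^ (r + 1) * (n : ℝ) ^ (r + 1 + 1)) := by
          gcongr
        -- The condition at `r + 1` says `(r + 1) ^ 2 ≤ 16 * n ^ 2 / (r + 1)`.
        have s2 : ((r : ℝ) + 1) ^ 2 * hookSum n r ≤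
            (16 * (n : ℝ) ^ 2 / (r + 1)) * (r * 4 ^ r * (n : ℝ) ^ (r + 1)) := by
          gcongr
          rw [le_div_iff₀ (by positivity)]
          nlinarith
        calc _ ≤ ((r : ℝ) + 2) / (r + 3) * (2 * (2 * r + 3) * n / (r + 1) *
            (((r : ℝ) + 1) * 4 ^ (r + 1) * (n : ℝ) ^ (r + 1 + 1)) +
            (16 * (n : ℝ) ^ 2 / (r + 1)) * (r * 4 ^ r * (n : ℝ) ^ (r + 1))) := by gcongr
          _ = (((r : ℝ) + 2) / (r + 3) * ((2 * r + 3) / 2 + r / (r + 1))) *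
            (4 ^ (r + 2) * (n : ℝ) ^ (r + 3)) := by
              field_simp
              ring
          _ ≤ (r + 2) * (4 ^ (r + 2) * (n : ℝ) ^ (r + 3)) := by
              gcongr
              have h : (2 * (r : ℝ) + 3) / 2 + r / (r + 1) ≤ r + 3 := by
                rw [div_add_div _ _ (by norm_num) (by positivity), div_le_iff₀ (by positivity)]
                nlinarith
              rw [div_mul_eq_mul_div, div_le_iff₀ (by positivity)]
              gcongr
          _ = _ := by ring

/-! ### Colourings constant on cycles -/

section Colourings

variable {α β : Type*}

/-- The number of colourings of `α` by `C` that are constant on the cycles of `σ`. -/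
noncomputable def colouringCount (C : Type*) (σ : Perm α) : ℕ :=
  Nat.card {f : α → C // ∀ x, f (σ x) = f x}

lemma colouringCount_permCongr (C : Type*) (e : α ≃ β) (σ : Perm α) :
    colouringCount C (e.permCongr σ) = colouringCount C σ := by
  refine Nat.card_congr ((e.arrowCongr (Equiv.refl C)).subtypeEquiv fun f => ?_).symm
  constructor
  · intro h x
    simpa using h (e.symm x)
  · intro h x
    simpa using h (e x)

lemma colouringCount_conj (C : Type*) (g σ : Perm α) :
    colouringCount C (g * σ * g⁻¹) = colouringCount C σ := by
  have : g * σ * g⁻¹ = g.permCongr σ := by ext x; simp [Perm.mul_apply]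
  rw [this, colouringCount_permCongr]

lemma colouringCount_mul_comm (C : Type*) (g σ : Perm α) :
    colouringCount C (g * σ) = colouringCount C (σ * g) := by
  rw [← colouringCount_conj C g (σ * g)]
  simp [mul_assoc]

lemma colouringCount_sumCongr (C : Type*) (p : Perm α) (q : Perm β) :
    colouringCount C (Perm.sumCongr p q) = colouringCount C p * colouringCount C q := by
  unfold colouringCount
  rw [← Nat.card_prod]
  refine Nat.card_congr
    { toFun := fun f => (⟨fun x => f.1 (Sum.inl x), fun x => by simpa using f.2 (Sum.inl x)⟩,
        ⟨fun x => f.1 (Sum.inr x), fun x => by simpa using f.2 (Sum.inr x)⟩)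
      invFun := fun f => ⟨Sum.elim f.1.1 f.2.1, ?_⟩
      left_inv := fun f => ?_
      right_inv := fun f => ?_ }
  · rintro (x | x)
    · simpa using f.1.2 x
    · simpa using f.2.2 x
  · ext x
    rcases x with x | x <;> rfl
  · rfl

lemma colouringCount_optionCongr (C : Type*) (σ : Perm α) :
    colouringCount C (optionCongr σ) = Nat.card C * colouringCount C σ := by
  unfold colouringCount
  rw [← Nat.card_prod]
  refine Nat.card_congr
    { toFun := fun f => (f.1 none, ⟨fun x => f.1 (some x), fun x => by simpa using f.2 (some x)⟩)
      invFun := fun f => ⟨fun x => x.elim f.1 f.2.1, ?_⟩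
      left_inv := fun f => ?_
      right_inv := fun f => ?_ }
  · rintro (_ | x)
    · simp
    · simpa using f.2.2 x
  · ext x
    rcases x with _ | x <;> rfl
  · rfl

/-- The transposition inserts `none` into the cycle of `a`, so the colour of `none` is forced. -/
lemma colouringCount_swap_mul_optionCongr [DecidableEq α] (C : Type*) (σ : Perm α) (a : α) :
    colouringCount C (swap none (some a) * optionCongr σ) = colouringCount C σ := by
  have hs : ∀ f : Option α → C, f none = f (some a) → ∀ x, f (swap none (some a) x) = f x := by
    intro f hf x
    rcases eq_or_ne x none with rfl | h1
    · simp [hf]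
    · rcases eq_or_ne x (some a) with rfl | h2
      · simp [hf]
      · rw [swap_apply_of_ne_of_ne h1 h2]
  refine Nat.card_congr
    { toFun := fun f => ⟨fun x => f.1 (some x), fun x => ?_⟩
      invFun := fun f => ⟨fun x => x.elim (f.1 a) f.1, ?_⟩
      left_inv := fun f => ?_
      right_inv := fun f => ?_ }
  · have h0 : f.1 none = f.1 (some a) := by simpa [Perm.mul_apply] using (f.2 none).symm
    have := f.2 (some x)
    rw [Perm.mul_apply, hs f.1 h0] at this
    simpa using this
  · intro x
    rw [Perm.mul_apply]
    refine (hs (fun x => x.elim (f.1 a) f.1) rfl _).trans ?_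
    rcases x with _ | x
    · simp
    · simpa using f.2 x
  · have h0 : f.1 none = f.1 (some a) := by simpa [Perm.mul_apply] using (f.2 none).symm
    ext x
    rcases x with _ | x
    · exact h0.symm
    · rfl
  · rfl

lemma sum_perm_option [Fintype α] [DecidableEq α] (F : Perm (Option α) → ℝ) :
    ∑ σ, F σ = ∑ σ : Perm α, (F (optionCongr σ) + ∑ a, F (swap none (some a) * optionCongr σ)) := by
  rw [← (Perm.decomposeOption (α := α)).symm.sum_comp, Fintype.sum_prod_type_right]
  refine Finset.sum_congr rfl fun σ _ => ?_
  rw [Fintype.sum_option]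
  simp [Perm.decomposeOption, ← Perm.one_def]

/-- The generating function of the number of cycles, weighted by a power of the sign. -/
lemma sum_sign_pow_mul_colouringCount.{u} (C : Type*) [Finite C] (j : ℕ) (α : Type u) [Fintype α]
    [DecidableEq α] :
    ∑ σ : Perm α, (((Perm.sign σ : ℤ) : ℝ) ^ j * colouringCount C σ) =
      ∏ i ∈ Finset.range (Fintype.card α), ((Nat.card C : ℝ) + (-1) ^ j * i) := by
  refine Fintype.induction_empty_option (P := fun α _ => ∀ [DecidableEq α],
    ∑ σ : Perm α, (((Perm.sign σ : ℤ) : ℝ) ^ j * colouringCount C σ) =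
      ∏ i ∈ Finset.range (Fintype.card α), ((Nat.card C : ℝ) + (-1) ^ j * i)) ?_ ?_ ?_ α
  · intro α β _ e ih _
    classical
    let _ := Fintype.ofEquiv β e.symm
    rw [← Fintype.card_congr e, ← ih, ← e.permCongr.sum_comp]
    refine Finset.sum_congr rfl fun σ _ => ?_
    rw [Perm.sign_permCongr, colouringCount_permCongr]
  · intro _
    have : Unique {f : PEmpty.{u + 1} → C // ∀ x, f ((1 : Perm PEmpty.{u + 1}) x) = f x} :=
      ⟨⟨⟨fun x => x.elim, fun x => x.elim⟩⟩, fun f => Subtype.ext (funext fun x => x.elim)⟩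
    rw [Fintype.sum_unique]
    have h1 : (default : Perm PEmpty.{u + 1}) = (1 : Perm PEmpty.{u + 1}) := Subsingleton.elim _ _
    rw [h1]
    simp [colouringCount]
  · intro α _ ih inst
    classical
    obtain rfl : inst = Option.instDecidableEq := Subsingleton.elim _ _
    rw [sum_perm_option, Fintype.card_option, Finset.prod_range_succ, ← ih, Finset.sum_mul]
    refine Finset.sum_congr rfl fun σ _ => ?_
    simp only [colouringCount_optionCongr, optionCongr_sign, Perm.sign_mul,
      Perm.sign_swap (Option.some_ne_none _).symm]
    have : ∀ a : α, colouringCount C (swap none (some a) * optionCongr σ) = colouringCount C σ :=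
      fun a => by convert colouringCount_swap_mul_optionCongr C σ a
    simp only [this, Finset.sum_const, Finset.card_univ, nsmul_eq_mul]
    push_cast
    ring

/-- Multiplying a block permutation by a transposition of points in different blocks merges their
two cycles. -/
lemma colouring_swap_iff [Finite β] [DecidableEq (α ⊕ β)] {C : Type*} (p : Perm α) (q : Perm β)
    (i : α) (k : β) (f : α ⊕ β → C) :
    (∀ x, f ((Perm.sumCongr p q * swap (Sum.inl i) (Sum.inr k)) x) = f x) ↔
      (∀ x, f (Perm.sumCongr p q x) = f x) ∧ f (Sum.inl i) = f (Sum.inr k) := by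
  have hs : ∀ f : α ⊕ β → C, f (Sum.inl i) = f (Sum.inr k) →
      ∀ x, f (swap (Sum.inl i) (Sum.inr k) x) = f x := by
    intro f hf x
    rcases eq_or_ne x (Sum.inl i) with rfl | h1
    · simp [hf]
    · rcases eq_or_ne x (Sum.inr k) with rfl | h2
      · simp [hf]
      · rw [swap_apply_of_ne_of_ne h1 h2]
  constructor
  · intro h
    have h1 : f (Sum.inr (q k)) = f (Sum.inl i) := by
      simpa [Perm.mul_apply] using h (Sum.inl i)
    have h2 : f (Sum.inr k) = f (Sum.inr (q k)) := by
      -- If the colours differ, the points of the second block coloured like `q k` avoid `k`, so `q`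
      -- maps them to themselves. By finiteness `q` is onto this set, and `k`, the only preimage of
      -- `q k`, would lie in it.
      by_contra hne
      set B : Set β := {y | f (Sum.inr y) = f (Sum.inr (q k))} with hB
      have hmaps : Set.MapsTo q B B := by
        intro y hy
        have hyk : y ≠ k := by
          rintro rfl
          exact hne hy
        have := h (Sum.inr y)
        rw [Perm.mul_apply, swap_apply_of_ne_of_ne (by simp) (by simpa using hyk)] at this
        simp only [Perm.sumCongr_apply, Sum.map_inr] at this
        exact this.trans hy
      have hsurj := Finite.surjective_of_injective
        ((hmaps.restrict_inj).2 q.injective.injOn)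
      obtain ⟨⟨y, hy⟩, hyk⟩ := hsurj ⟨q k, rfl⟩
      obtain rfl : y = k := q.injective (Subtype.ext_iff.mp hyk)
      exact hne hy
    have h3 : f (Sum.inl i) = f (Sum.inr k) := by rw [h2, h1]
    refine ⟨fun x => ?_, h3⟩
    have := h (swap (Sum.inl i) (Sum.inr k) x)
    rw [Perm.mul_apply, swap_apply_self, hs f h3] at this
    exact this
  · rintro ⟨h, h3⟩ x
    rw [Perm.mul_apply, h, hs f h3]

/-- Merging two cycles loses one free colour. The group structure on `C` makes this a bijection: a
colouring of the blocks is one with matching colours at `i` and `k`, together with a translation of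
the colours of the second block. -/
lemma card_mul_colouringCount_swap [Finite β] [DecidableEq (α ⊕ β)] (C : Type*) [AddGroup C]
    (p : Perm α) (q : Perm β) (i : α) (k : β) :
    Nat.card C * colouringCount C (Perm.sumCongr p q * swap (Sum.inl i) (Sum.inr k)) =
      colouringCount C (Perm.sumCongr p q) := by
  unfold colouringCount
  rw [← Nat.card_prod]
  simp only [colouring_swap_iff]
  refine Nat.card_congr
    { toFun := fun f => ⟨fun x => x.elim (fun y => f.2.1 (Sum.inl y))
          (fun y => f.2.1 (Sum.inr y) + f.1), ?_⟩
      invFun := fun f => (- f.1 (Sum.inl i) + f.1 (Sum.inr k),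
        ⟨fun x => x.elim (fun y => f.1 (Sum.inl y))
          (fun y => f.1 (Sum.inr y) - (- f.1 (Sum.inl i) + f.1 (Sum.inr k))), ?_⟩)
      left_inv := fun f => ?_
      right_inv := fun f => ?_ }
  · have := f.2.2.1
    rintro (x | x)
    · simpa using this (Sum.inl x)
    · simpa using this (Sum.inr x)
  · refine ⟨?_, by simp [sub_eq_add_neg]⟩
    have := f.2
    rintro (x | x)
    · simpa using this (Sum.inl x)
    · simpa using this (Sum.inr x)
  · have := f.2.2.2
    refine Prod.ext ?_ (Subtype.ext (funext fun x => ?_))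
    · simp [this, ← add_assoc]
    · rcases x with x | x <;> simp [this, ← add_assoc]
  · refine Subtype.ext (funext fun x => ?_)
    rcases x with x | x <;> simp

/-- The normalized number of colourings is monotone in the number of colours. -/
lemma mul_colouringCount_le [Finite α] [Nonempty α] {m n : ℕ} (hmn : m ≤ n) (σ : Perm α) :
    n * colouringCount (Fin m) σ ≤ m * colouringCount (Fin n) σ := by
  obtain ⟨a⟩ := ‹Nonempty α›
  rcases Nat.eq_zero_or_pos m with rfl | hm
  · have : IsEmpty {f : α → Fin 0 // ∀ x, f (σ x) = f x} := ⟨fun f => (f.1 a).elim0⟩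
    simp [colouringCount]
  -- Translating colours modulo `l` normalizes the colour of `a` to `0`. Normalized colourings with
  -- `m` colours embed into those with `n`.
  have key : ∀ l : ℕ, 0 < l → ∀ h : 0 < l, colouringCount (Fin l) σ =
      l * Nat.card {f : α → Fin l // (∀ x, f (σ x) = f x) ∧ f a = ⟨0, h⟩} := by
    intro l hl h
    have : NeZero l := ⟨hl.ne'⟩
    unfold colouringCount
    trans Nat.card (Fin l × {f : α → Fin l // (∀ x, f (σ x) = f x) ∧ f a = ⟨0, h⟩})
    swap
    · rw [Nat.card_prod, Nat.card_fin]
    refine Nat.card_congr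
      { toFun := fun f => (f.1 a, ⟨fun x => f.1 x - f.1 a, fun x => congrArg (· - f.1 a) (f.2 x), ?_⟩)
        invFun := fun f => ⟨fun x => f.2.1 x + f.1, fun x => congrArg (· + f.1) (f.2.2.1 x)⟩
        left_inv := fun f => ?_
        right_inv := fun f => ?_ }
    · exact sub_self (f.1 a)
    · refine Subtype.ext (funext fun x => ?_)
      simp
    · have h0 : f.2.1 a = 0 := f.2.2.2
      refine Prod.ext ?_ (Subtype.ext (funext fun x => ?_)) <;> simp [h0]
  rw [key m hm hm, key n (by omega) (by omega)]
  have : Nat.card {f : α → Fin m // (∀ x, f (σ x) = f x) ∧ f a = ⟨0, hm⟩} ≤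
      Nat.card {f : α → Fin n // (∀ x, f (σ x) = f x) ∧ f a = ⟨0, by omega⟩} := by
    refine Nat.card_le_card_of_injective
      (fun f => ⟨fun x => Fin.castLE hmn (f.1 x), fun x => congrArg _ (f.2.1 x),
        congrArg (Fin.castLE hmn) f.2.2⟩) ?_
    intro f g hfg
    refine Subtype.ext (funext fun x => ?_)
    have := congrFun (Subtype.ext_iff.mp hfg) x
    exact Fin.castLE_injective hmn this
  calc _ = (m * n) * Nat.card {f : α → Fin m // (∀ x, f (σ x) = f x) ∧ f a = ⟨0, hm⟩} := by ring
    _ ≤ (m * n) * Nat.card {f : α → Fin n // (∀ x, f (σ x) = f x) ∧ f a = ⟨0, by omega⟩} :=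
      Nat.mul_le_mul_left _ this
    _ = _ := by ring

end Colourings

/-! ### Sign-twisted sums over block subgroups -/

/-- The sign of the first component, as a real number. -/
noncomputable def blockSign {ι κ : Type*} [Fintype ι] [DecidableEq ι] (h : Perm ι × Perm κ) : ℝ :=
  ((Perm.sign h.1 : ℤ) : ℝ)

lemma blockSign_mul {ι κ : Type*} [Fintype ι] [DecidableEq ι] (g h : Perm ι × Perm κ) :
    blockSign (g * h) = blockSign g * blockSign h := by
  simp [blockSign]

lemma blockSign_mul_self {ι κ : Type*} [Fintype ι] [DecidableEq ι] (h : Perm ι × Perm κ) :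
    blockSign h * blockSign h = 1 := by
  unfold blockSign
  exact_mod_cast Int.units_coe_mul_self (Perm.sign h.1)

section BlockSums

variable {ι κ : Type*} [Fintype ι] [Fintype κ] [DecidableEq ι] [DecidableEq κ]

/-- The colouring counts of the coset of `σ` under block permutations, summed with the sign of the
first block. -/
noncomputable def blockSum (C : Type*) (σ : Perm (ι ⊕ κ)) : ℝ :=
  ∑ h : Perm ι × Perm κ, blockSign h * colouringCount C (Perm.sumCongrHom ι κ h * σ)

lemma blockSum_mul_left (C : Type*) (g : Perm ι × Perm κ) (σ : Perm (ι ⊕ κ)) :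
    blockSum C (Perm.sumCongrHom ι κ g * σ) = blockSign g * blockSum C σ := by
  unfold blockSum
  rw [← Equiv.sum_comp (Equiv.mulRight g) (fun h => blockSign h * (colouringCount C
    (Perm.sumCongrHom ι κ h * σ) : ℝ)), Finset.mul_sum]
  refine Finset.sum_congr rfl fun h _ => ?_
  simp only [Equiv.coe_mulRight, blockSign_mul, map_mul, mul_assoc]
  linear_combination (-blockSign h * (colouringCount C
    (Perm.sumCongrHom ι κ h * (Perm.sumCongrHom ι κ g * σ)) : ℝ)) * blockSign_mul_self g

/-- The colouring count is a class function, so a right factor can be moved to the left at the cost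
of conjugating the summation variable. -/
lemma blockSum_mul_right (C : Type*) (g : Perm ι × Perm κ) (σ : Perm (ι ⊕ κ)) :
    blockSum C (σ * Perm.sumCongrHom ι κ g) = blockSign g * blockSum C σ := by
  rw [← blockSum_mul_left]
  unfold blockSum
  rw [← Equiv.sum_comp (MulAut.conj g).toEquiv (fun h => blockSign h * (colouringCount C
    (Perm.sumCongrHom ι κ h * (Perm.sumCongrHom ι κ g * σ)) : ℝ))]
  refine Finset.sum_congr rfl fun h _ => ?_
  congr 1
  · simp only [MulEquiv.toEquiv_eq_coe, EquivLike.coe_coe, MulAut.conj_apply, blockSign_mul]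
    have := blockSign_mul_self g
    have h2 : blockSign g⁻¹ = blockSign g := by simp [blockSign]
    rw [h2]
    linear_combination (-blockSign h) * this
  · norm_cast
    simp only [MulEquiv.toEquiv_eq_coe, EquivLike.coe_coe, MulAut.conj_apply, map_mul, map_inv]
    rw [← mul_assoc, colouringCount_mul_comm]
    simp only [mul_assoc, inv_mul_cancel_left]

lemma blockSum_one (C : Type*) [Finite C] :
    blockSum C (1 : Perm (ι ⊕ κ)) = (∏ i ∈ Finset.range (Fintype.card ι), ((Nat.card C : ℝ) - i)) *
      ∏ i ∈ Finset.range (Fintype.card κ), ((Nat.card C : ℝ) + i) := by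
  have h1 := sum_sign_pow_mul_colouringCount C 1 ι
  have h2 := sum_sign_pow_mul_colouringCount C 0 κ
  simp only [pow_one, pow_zero, one_mul, neg_one_mul, ← sub_eq_add_neg] at h1 h2
  rw [← h1, ← h2, Finset.sum_mul_sum, ← Fintype.sum_prod_type']
  unfold blockSum
  refine Finset.sum_congr rfl fun h _ => ?_
  simp [blockSign, colouringCount_sumCongr, mul_assoc]

lemma card_mul_blockSum_swap (C : Type*) [AddGroup C] (i : ι) (k : κ) :
    Nat.card C * blockSum C (swap (Sum.inl i) (Sum.inr k)) = blockSum C (1 : Perm (ι ⊕ κ)) := by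
  unfold blockSum
  rw [Finset.mul_sum]
  refine Finset.sum_congr rfl fun h _ => ?_
  have := card_mul_colouringCount_swap C h.1 h.2 i k
  rw [mul_one, Perm.sumCongrHom_apply, ← this]
  push_cast
  ring

/-- The transposition of `k` and `k'` on the left of `σ` equals that of `i` and `i'` on the right.
The former has block sign `1`, the latter `-1`. -/
lemma blockSum_eq_zero (C : Type*) (σ : Perm (ι ⊕ κ)) {i i' : ι} {k k' : κ} (hi : i ≠ i')
    (h : σ (Sum.inl i) = Sum.inr k) (h' : σ (Sum.inl i') = Sum.inr k') : blockSum C σ = 0 := by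
  have key : Perm.sumCongrHom ι κ (1, swap k k') * σ =
      σ * Perm.sumCongrHom ι κ (swap i i', 1) := by
    rw [Perm.sumCongrHom_apply, Perm.sumCongrHom_apply, Perm.sumCongr_one_swap,
      Perm.sumCongr_swap_one, ← h, ← h', Equiv.mul_swap_eq_swap_mul]
  have h1 := blockSum_mul_left C (1, swap k k') σ
  rw [key, blockSum_mul_right] at h1
  simp [blockSign, Perm.sign_swap hi] at h1
  linarith

/-- Permutations mapping all but at most one point of the first block to the first block. -/
noncomputable def nearBlock {ι κ : Type*} [DecidableEq ι] [DecidableEq κ]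
    (s : Option (ι × κ) × (Perm ι × Perm κ)) : Perm (ι ⊕ κ) :=
  s.1.elim 1 (fun x => swap (Sum.inl x.1) (Sum.inr x.2)) * Perm.sumCongrHom ι κ s.2

/-- The crossing pair can be read off from the permutation: `k` is the image in the second block of
a point of the first, and `i` is the reverse crossing. Cancelling the transposition then recovers
the block part. -/
lemma nearBlock_injective {ι κ : Type*} [DecidableEq ι] [DecidableEq κ] : Function.Injective (nearBlock (ι := ι) (κ := κ)) := by
  have key : ∀ (o : Option (ι × κ)) h (i : ι) (k : κ),
      nearBlock (o, h) (Sum.inl (h.1⁻¹ i)) = Sum.inr k ↔ o = some (i, k) := by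
    rintro (_ | ⟨i', k'⟩) h i k
    · simp [nearBlock]
    · have hinv : h.1 (h.1⁻¹ i) = i := by simp
      simp only [nearBlock, Option.elim, Perm.mul_apply, Perm.sumCongrHom_apply,
        Perm.sumCongr_apply, Sum.map_inl, hinv, Option.some.injEq, Prod.mk.injEq]
      rcases eq_or_ne i i' with rfl | hne
      · simp
      · rw [swap_apply_of_ne_of_ne (by simpa using hne) (by simp)]
        simp [hne.symm]
  have key2 : ∀ (o : Option (ι × κ)) h (j : ι) (k : κ),
      nearBlock (o, h) (Sum.inl j) = Sum.inr k ↔ o = some (h.1 j, k) := by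
    intro o h j k
    rw [← key o h (h.1 j) k]
    simp
  have key3 : ∀ (o : Option (ι × κ)) h (j : κ) (i : ι),
      nearBlock (o, h) (Sum.inr j) = Sum.inl i ↔ o = some (i, h.2 j) := by
    rintro (_ | ⟨i', k'⟩) h j i
    · simp [nearBlock]
    · simp only [nearBlock, Option.elim, Perm.mul_apply, Perm.sumCongrHom_apply,
        Perm.sumCongr_apply, Sum.map_inr, Option.some.injEq, Prod.mk.injEq]
      rcases eq_or_ne (h.2 j) k' with hk | hne
      · simp [hk]
      · rw [swap_apply_of_ne_of_ne (by simp) (by simpa using hne)]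
        simp [hne.symm]
  rintro ⟨o, h⟩ ⟨o', h'⟩ heq
  have ho : o = o' := by
    rcases o with _ | ⟨i, k⟩
    · rcases o' with _ | ⟨i', k'⟩
      · rfl
      · have := (key (some (i', k')) h' i' k').2 rfl
        rw [← heq, key2] at this
        exact absurd this (by simp)
    · have h1 := (key (some (i, k)) h i k).2 rfl
      rw [heq, key2] at h1
      have h2 := (key3 (some (i, k)) h (h.2⁻¹ k) i).2 (by simp)
      rw [heq, key3] at h2
      rw [h2] at h1 ⊢
      simp only [Option.some.injEq, Prod.mk.injEq] at h1 ⊢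
      exact ⟨trivial, h1.2.symm⟩
  subst ho
  have : Perm.sumCongrHom ι κ h = Perm.sumCongrHom ι κ h' := mul_left_cancel heq
  rw [Perm.sumCongrHom_injective this]

/-- If one point of the first block leaves it, some `j` of the first block is missed by the images
of that block. Composing with the transposition of `j` and the escaped image restores invariance of
the block. -/
lemma mem_range_nearBlock (σ : Perm (ι ⊕ κ))
    (hσ : ∀ (i i' : ι) (k k' : κ), σ (Sum.inl i) = Sum.inr k → σ (Sum.inl i') = Sum.inr k' →
      i = i') : σ ∈ Set.range (nearBlock (ι := ι) (κ := κ)) := by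
  by_cases h0 : Set.MapsTo σ (Set.range Sum.inl) (Set.range Sum.inl)
  · obtain ⟨h, hh⟩ := Perm.mem_sumCongrHom_range_of_perm_mapsTo_inl h0
    exact ⟨(none, h), by simpa [nearBlock] using hh⟩
  · have hex : ∃ i k, σ (Sum.inl i) = Sum.inr k := by
      simp only [Set.MapsTo, Set.mem_range, not_forall] at h0
      obtain ⟨_, ⟨i, rfl⟩, h⟩ := h0
      rcases hx : σ (Sum.inl i) with y | k
      · exact absurd ⟨y, hx.symm⟩ h
      · exact ⟨i, k, hx⟩
    obtain ⟨i, k, hik⟩ := hex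
    have hex' : ∃ j : ι, ∀ i', σ (Sum.inl i') ≠ Sum.inl j := by
      by_contra hcon
      push Not at hcon
      choose f hf using hcon
      have hfi : Function.Injective f := by
        intro a b hab
        have := hf a
        rw [hab, hf b] at this
        exact (Sum.inl_injective this).symm
      obtain ⟨j, hj⟩ := (Finite.injective_iff_surjective.1 hfi) i
      have := hf j
      rw [hj, hik] at this
      simp at this
    obtain ⟨j, hj⟩ := hex'
    have hmaps : Set.MapsTo (swap (Sum.inl j) (Sum.inr k) * σ : Perm (ι ⊕ κ))
        (Set.range Sum.inl) (Set.range Sum.inl) := by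
      rintro _ ⟨i', rfl⟩
      rw [Perm.mul_apply]
      rcases eq_or_ne i' i with rfl | hne
      · rw [hik]
        simp
      · rcases hx : σ (Sum.inl i') with y | k'
        · rw [swap_apply_of_ne_of_ne (by rintro h; exact hj i' (hx.trans h)) (by simp)]
          exact ⟨y, rfl⟩
        · exact absurd (hσ _ _ _ _ hx hik) hne
    obtain ⟨h, hh⟩ := Perm.mem_sumCongrHom_range_of_perm_mapsTo_inl hmaps
    exact ⟨(some (j, k), h), by simp [nearBlock, hh]⟩

/-- The twisted convolution of two colouring counts over a block subgroup. -/
lemma sum_block_mul_colouringCount (C₁ C₂ : Type*) [AddGroup C₁] [AddGroup C₂] [Finite C₁]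
    [Finite C₂] :
    ∑ h : Perm ι × Perm κ, blockSign h * ∑ σ : Perm (ι ⊕ κ),
      (colouringCount C₁ σ : ℝ) * colouringCount C₂ (Perm.sumCongrHom ι κ h * σ) =
    blockSum C₁ (1 : Perm (ι ⊕ κ)) * blockSum C₂ (1 : Perm (ι ⊕ κ)) *
      (1 + Fintype.card ι * Fintype.card κ / (Nat.card C₁ * Nat.card C₂)) := by
  set φ := Perm.sumCongrHom ι κ
  set N : ℝ := (Fintype.card (Perm ι × Perm κ) : ℝ) with hN
  have hN0 : N ≠ 0 := by
    rw [hN]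
    exact_mod_cast Fintype.card_ne_zero
  -- Averaging over translations by the subgroup replaces both colouring counts by their equivariant
  -- block sums.
  have e1 : N * ∑ h : Perm ι × Perm κ, blockSign h * ∑ σ : Perm (ι ⊕ κ),
      (colouringCount C₁ σ : ℝ) * colouringCount C₂ (φ h * σ) =
      ∑ σ : Perm (ι ⊕ κ), blockSum C₁ σ * blockSum C₂ σ := by
    have : ∀ g : Perm ι × Perm κ, ∑ h : Perm ι × Perm κ, blockSign h * ∑ σ : Perm (ι ⊕ κ),
        (colouringCount C₁ σ : ℝ) * colouringCount C₂ (φ h * σ) =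
        ∑ σ : Perm (ι ⊕ κ), blockSign g * (colouringCount C₁ (φ g * σ) : ℝ) * blockSum C₂ σ := by
      intro g
      have h1 : ∀ σ : Perm (ι ⊕ κ), blockSign g * (colouringCount C₁ (φ g * σ) : ℝ) *
          blockSum C₂ σ = (colouringCount C₁ (φ g * σ) : ℝ) * blockSum C₂ (φ g * σ) := by
        intro σ
        rw [blockSum_mul_left]
        ring
      simp only [h1]
      refine Eq.trans ?_ (Equiv.sum_comp (Equiv.mulLeft (φ g))
        (fun σ => (colouringCount C₁ σ : ℝ) * blockSum C₂ σ)).symm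
      simp only [blockSum, Finset.mul_sum]
      rw [Finset.sum_comm]
      refine Finset.sum_congr rfl fun σ _ => Finset.sum_congr rfl fun h _ => ?_
      ring
    rw [hN, ← nsmul_eq_mul, ← Finset.card_univ, ← Finset.sum_const,
      Finset.sum_congr rfl (fun g _ => this g), Finset.sum_comm]
    refine Finset.sum_congr rfl fun σ _ => ?_
    rw [← Finset.sum_mul]
    rfl
  have e2 : ∑ σ : Perm (ι ⊕ κ), blockSum C₁ σ * blockSum C₂ σ =
      ∑ s : Option (ι × κ) × (Perm ι × Perm κ),
        blockSum C₁ (nearBlock s) * blockSum C₂ (nearBlock s) := by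
    refine (Fintype.sum_of_injective nearBlock nearBlock_injective _ _ ?_ fun s => rfl).symm
    intro σ hσ
    by_contra hne
    refine hσ (mem_range_nearBlock σ fun i i' k k' h h' => ?_)
    by_contra hii
    rw [blockSum_eq_zero C₁ σ hii h h', zero_mul] at hne
    exact hne rfl
  have hC₁ : (Nat.card C₁ : ℝ) ≠ 0 := by exact_mod_cast Nat.card_pos.ne'
  have hC₂ : (Nat.card C₂ : ℝ) ≠ 0 := by exact_mod_cast Nat.card_pos.ne'
  have e3 : ∀ (o : Option (ι × κ)) (h : Perm ι × Perm κ),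
      blockSum C₁ (nearBlock (o, h)) * blockSum C₂ (nearBlock (o, h)) =
      blockSum C₁ (1 : Perm (ι ⊕ κ)) * blockSum C₂ (1 : Perm (ι ⊕ κ)) *
        o.elim (1 : ℝ) (fun _ => 1 / ((Nat.card C₁ : ℝ) * Nat.card C₂)) := by
    intro o h
    simp only [nearBlock, blockSum_mul_right]
    have hh := blockSign_mul_self h
    rcases o with _ | ⟨i, k⟩
    · simp only [Option.elim]
      linear_combination (blockSum C₁ (1 : Perm (ι ⊕ κ)) * blockSum C₂ (1 : Perm (ι ⊕ κ))) * hh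
    · simp only [Option.elim]
      rw [← card_mul_blockSum_swap C₁ i k, ← card_mul_blockSum_swap C₂ i k]
      field_simp
      linear_combination (blockSum C₁ (swap (Sum.inl i) (Sum.inr k)) *
        blockSum C₂ (swap (Sum.inl i) (Sum.inr k))) * hh
  refine mul_left_cancel₀ hN0 ?_
  rw [e1, e2, Fintype.sum_prod_type]
  simp only [e3, Fintype.sum_option, Option.elim, Finset.sum_const, Finset.card_univ,
    nsmul_eq_mul, Fintype.card_prod, hN]
  push_cast
  ring

end BlockSums

/-! ### Detecting long cycles by inclusion–exclusion -/

section LongCycles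

variable {α : Type*} [Fintype α] [DecidableEq α]

/-- The sign of the restriction of `g` to `S`, or `0` if `S` is not invariant. -/
noncomputable def restrictSign (g : Perm α) (S : Finset α) : ℝ :=
  if h : ∀ x, g x ∈ S ↔ x ∈ S then ((Perm.sign (g.subtypePerm h) : ℤ) : ℝ) else 0

lemma mem_iff_of_sameCycle {α : Type*} {g : Perm α} {S : Finset α} (h : ∀ x, g x ∈ S ↔ x ∈ S) {x y : α}
    (hxy : g.SameCycle x y) : x ∈ S ↔ y ∈ S := by
  obtain ⟨i, rfl⟩ := hxy
  induction i with
  | zero => simp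
  | succ i ih =>
    rw [ih, ← h, ← Perm.mul_apply, ← zpow_one_add, add_comm]
  | pred i ih =>
    rw [ih, ← h ((g ^ (-(i : ℤ) - 1)) x), ← Perm.mul_apply, ← zpow_one_add]
    simp

/-- On an invariant set the signed quantity is `(-1)` to the number of cycles in the set, so one
more cycle flips it. If `S` is not invariant, neither is `S ∪ C`, and both sides vanish. -/
lemma restrictSign_union_cycle {g : Perm α} {S C : Finset α} {x : α}
    (hC : ∀ y, y ∈ C ↔ g.SameCycle x y) (hSC : Disjoint S C) :
    (-1) ^ (S ∪ C).card * restrictSign g (S ∪ C) = - ((-1) ^ S.card * restrictSign g S) := by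
  have hCg : ∀ y, g y ∈ C ↔ y ∈ C := by
    intro y
    rw [hC, hC, Perm.sameCycle_apply_right]
  by_cases hS : ∀ y, g y ∈ S ↔ y ∈ S
  · have hU : ∀ y, g y ∈ S ∪ C ↔ y ∈ S ∪ C := by
      intro y
      rw [Finset.mem_union, Finset.mem_union, hS, hCg]
    have hsgn : Perm.sign (g.cycleOf x) = -(-1) ^ C.card := by
      by_cases hx : g x = x
      · have : C = {x} := by
          ext y
          rw [hC, Finset.mem_singleton]
          constructor
          · intro h
            exact (h.eq_of_left hx).symm
          · rintro rfl
            exact Perm.SameCycle.refl _ _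
        rw [(Perm.cycleOf_eq_one_iff g).2 hx, this]
        simp
      · rw [(Perm.isCycle_cycleOf g hx).sign]
        congr 3
        ext y
        rw [Perm.mem_support_cycleOf_iff, hC, Perm.mem_support]
        exact ⟨fun h => h.1, fun h => ⟨h, hx⟩⟩
    have hmul : Perm.ofSubtype (g.subtypePerm hU) =
        Perm.ofSubtype (g.subtypePerm hS) * g.cycleOf x := by
      ext y
      rw [Perm.mul_apply, Perm.cycleOf_apply]
      by_cases hyC : y ∈ C
      · rw [Perm.ofSubtype_apply_of_mem _ (Finset.mem_union_right _ hyC), if_pos ((hC y).1 hyC),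
          Perm.ofSubtype_apply_of_not_mem]
        · rfl
        · exact Finset.disjoint_right.1 hSC ((hCg y).2 hyC)
      · rw [if_neg (fun h => hyC ((hC y).2 h))]
        by_cases hyS : y ∈ S
        · rw [Perm.ofSubtype_apply_of_mem _ (Finset.mem_union_left _ hyS),
            Perm.ofSubtype_apply_of_mem _ hyS]
          rfl
        · rw [Perm.ofSubtype_apply_of_not_mem _ (by simp [hyS, hyC]),
            Perm.ofSubtype_apply_of_not_mem _ hyS]
    have hs := congrArg Perm.sign hmul
    rw [Perm.sign_mul, Perm.sign_ofSubtype, Perm.sign_ofSubtype, hsgn] at hs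
    rw [restrictSign, restrictSign, dif_pos hS, dif_pos hU, hs, Finset.card_union_of_disjoint hSC,
      pow_add]
    push_cast
    have : ((-1 : ℝ) ^ C.card) * (-1) ^ C.card = 1 := by
      rw [← mul_pow]
      simp
    linear_combination (-(-1) ^ S.card * ((Perm.sign (g.subtypePerm hS) : ℤ) : ℝ)) * this
  · have hU : ¬ ∀ y, g y ∈ S ∪ C ↔ y ∈ S ∪ C := by
      intro hU
      refine hS fun y => ?_
      have h1 := hU y
      rw [Finset.mem_union, Finset.mem_union, hCg] at h1
      have h2 : y ∈ S → y ∉ C := fun h => Finset.disjoint_left.1 hSC h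
      have h3 : g y ∈ S → g y ∉ C := fun h => Finset.disjoint_left.1 hSC h
      rw [hCg] at h3
      tauto
    rw [restrictSign, restrictSign, dif_neg hS, dif_neg hU]
    simp

/-- Inclusion–exclusion over the invariant sets detects long cycles. -/
lemma sum_powerset_restrictSign (g : Perm α) (a : α) [Decidable (∀ x, g.SameCycle a x)] :
    ∑ S ∈ (Finset.univ.erase a).powerset, (-1) ^ S.card * restrictSign g S =
      if ∀ x, g.SameCycle a x then 1 else 0 := by
  classical
  split_ifs with htr
  · rw [Finset.sum_eq_single ∅]
    · have : ∀ x, g x ∈ (∅ : Finset α) ↔ x ∈ (∅ : Finset α) := by simp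
      rw [restrictSign, dif_pos this]
      have h1 : g.subtypePerm this = 1 := Subsingleton.elim _ _
      rw [h1]
      simp
    · intro S hS hne
      rw [restrictSign, dif_neg, mul_zero]
      intro h
      obtain ⟨x, hx⟩ := Finset.nonempty_of_ne_empty hne
      have := (mem_iff_of_sameCycle h (htr x)).2 hx
      simpa using Finset.mem_powerset.1 hS this
    · simp
  · push Not at htr
    obtain ⟨x, hx⟩ := htr
    set C : Finset α := Finset.univ.filter fun y => g.SameCycle x y with hCdef
    have hC : ∀ y, y ∈ C ↔ g.SameCycle x y := by simp [hCdef]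
    have haC : a ∉ C := by
      rw [hC]
      exact fun h => hx h.symm
    have hxC : x ∈ C := (hC x).2 (Perm.SameCycle.refl _ _)
    -- Toggling a cycle `C` that avoids `a` pairs off the invariant sets with opposite signs. A set
    -- that meets `C` without containing it is not invariant, and neither is its partner.
    refine Finset.sum_involution (fun S _ => symmDiff S C) ?_ ?_ ?_ ?_
    · intro S _
      by_cases hd : Disjoint S C
      · have := restrictSign_union_cycle hC hd
        rw [show symmDiff S C = S ∪ C from hd.symmDiff_eq_sup, this]
        ring
      · by_cases hCS : C ⊆ S
        · have hd' : Disjoint (S \ C) C := Finset.sdiff_disjoint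
          have := restrictSign_union_cycle hC hd'
          rw [Finset.sdiff_union_of_subset hCS] at this
          rw [symmDiff_of_ge (show C ≤ S from hCS), this]
          ring
        · have hninv : ¬ ∀ y, g y ∈ S ↔ y ∈ S := by
            intro h
            rw [Finset.not_disjoint_iff] at hd
            obtain ⟨y, hyS, hyC⟩ := hd
            refine hCS fun z hz => ?_
            exact (mem_iff_of_sameCycle h (((hC y).1 hyC).symm.trans ((hC z).1 hz))).1 hyS
          have hninv' : ¬ ∀ y, g y ∈ symmDiff S C ↔ y ∈ symmDiff S C := by
            intro h
            refine hninv fun y => ?_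
            have h1 := h y
            have hCg : g y ∈ C ↔ y ∈ C := by
              rw [hC, hC, Perm.sameCycle_apply_right]
            rw [Finset.mem_symmDiff, Finset.mem_symmDiff, hCg] at h1
            tauto
          simp [restrictSign, hninv, hninv']
    · intro S _ _ heq
      have : C = ∅ := by simpa using heq
      rw [this] at hxC
      simp at hxC
    · intro S hS
      rw [Finset.mem_powerset] at hS ⊢
      intro y hy
      rw [Finset.mem_symmDiff] at hy
      rcases hy with hy | hy
      · exact hS hy.1
      · simp only [Finset.mem_erase, Finset.mem_univ, and_true]
        rintro rfl
        exact haC hy.1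
    · intro S _
      exact symmDiff_symmDiff_cancel_right C S

/-- Permutations preserving `S` are exactly the pairs of permutations of `S` and its complement, so
a sum against `restrictSign` is a sum over a block subgroup. -/
lemma sum_restrictSign_mul (S : Finset α) (G : Perm α → ℝ) :
    ∑ g, restrictSign g S * G g = ∑ h : Perm {x // x ∈ S} × Perm {x // x ∉ S},
      blockSign h * G (Perm.subtypeCongr h.1 h.2) := by
  refine (Fintype.sum_of_injective (fun h => Perm.subtypeCongr h.1 h.2)
    (Perm.subtypeCongrHom_injective (· ∈ S)) _ _ ?_ ?_).symm
  · intro g hg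
    rw [restrictSign, dif_neg, zero_mul]
    intro h
    refine hg ⟨(g.subtypePerm h, g.subtypePerm (p := (· ∉ S)) fun x => not_congr (h x)), ?_⟩
    ext x
    by_cases hx : x ∈ S
    · simp [hx]
    · simp [hx]
  · intro h
    have hS : ∀ x, Perm.subtypeCongr h.1 h.2 x ∈ S ↔ x ∈ S := by
      intro x
      by_cases hx : x ∈ S
      · simp [hx]
      · simp only [Perm.subtypeCongr.apply, hx, dite_false, iff_false]
        exact (h.2 ⟨x, hx⟩).2
    have hp : (Perm.subtypeCongr h.1 h.2).subtypePerm hS = h.1 := by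
      ext x
      simp
    rw [restrictSign, dif_pos hS, hp]
    rfl

/-- The convolution of two colouring counts. -/
noncomputable def colouringConv (C₁ C₂ : Type*) (g : Perm α) : ℝ :=
  ∑ σ : Perm α, (colouringCount C₁ σ : ℝ) * colouringCount C₂ (g * σ)

lemma colouringConv_conj (C₁ C₂ : Type*) (c g : Perm α) :
    colouringConv C₁ C₂ (c * g * c⁻¹) = colouringConv C₁ C₂ g := by
  unfold colouringConv
  rw [← Equiv.sum_comp (MulAut.conj c).toEquiv]
  refine Finset.sum_congr rfl fun σ _ => ?_
  simp only [MulEquiv.toEquiv_eq_coe, EquivLike.coe_coe, MulAut.conj_apply]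
  rw [colouringCount_conj, ← colouringCount_conj C₂ c (g * σ)]
  simp only [mul_assoc, inv_mul_cancel_left]

/-- The factor `x(x-1)⋯(x-b+1) · x(x+1)⋯(x+c-1)`. -/
noncomputable def blockFactor (x : ℝ) (b c : ℕ) : ℝ :=
  (∏ i ∈ Finset.range b, (x - i)) * ∏ i ∈ Finset.range c, (x + i)

lemma sum_blockSign_mul_colouringConv (C₁ C₂ : Type*) [AddGroup C₁] [AddGroup C₂] [Finite C₁]
    [Finite C₂] (S : Finset α) :
    ∑ h : Perm {x // x ∈ S} × Perm {x // x ∉ S},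
      blockSign h * colouringConv C₁ C₂ (Perm.subtypeCongr h.1 h.2) =
    blockFactor (Nat.card C₁) S.card (Fintype.card α - S.card) *
      blockFactor (Nat.card C₂) S.card (Fintype.card α - S.card) *
      (1 + S.card * (Fintype.card α - S.card : ℕ) / (Nat.card C₁ * Nat.card C₂)) := by
  have h := sum_block_mul_colouringCount (ι := {x // x ∈ S}) (κ := {x // x ∉ S}) C₁ C₂
  have hc : Fintype.card {x // x ∉ S} = Fintype.card α - S.card := by
    rw [Fintype.card_subtype_compl, Fintype.card_coe]
  rw [blockSum_one, blockSum_one, Fintype.card_coe, hc] at h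
  unfold blockFactor
  rw [← h]
  refine Finset.sum_congr rfl fun g _ => ?_
  congr 1
  unfold colouringConv
  rw [← Equiv.sum_comp (Equiv.sumCompl (· ∈ S)).permCongr]
  refine Finset.sum_congr rfl fun σ _ => ?_
  have e : Perm.subtypeCongr g.1 g.2 * (Equiv.sumCompl (· ∈ S)).permCongr σ =
      (Equiv.sumCompl (· ∈ S)).permCongr (Perm.sumCongrHom _ _ g * σ) := by
    ext x
    simp [Perm.subtypeCongr, Equiv.permCongr_apply, Perm.mul_apply]
  rw [e, colouringCount_permCongr, colouringCount_permCongr]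

lemma apply_ne_of_sameCycle {α : Type*} [Fintype α] (hα : 2 ≤ Fintype.card α) {g : Perm α} {a : α}
    (h : ∀ x, g.SameCycle a x) (y : α) : g y ≠ y := by
  intro hy
  obtain ⟨z, hz⟩ : ∃ z, z ≠ y := by
    have := Fintype.one_lt_card_iff_nontrivial.1 (show 1 < Fintype.card α by omega)
    exact exists_ne y
  exact hz (((h y).symm.trans (h z)).eq_of_left hy).symm

lemma forall_sameCycle_iff_cycleType (hα : 2 ≤ Fintype.card α) (g : Perm α) (a : α) :
    (∀ x, g.SameCycle a x) ↔ g.cycleType = {Fintype.card α} := by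
  constructor
  · intro h
    have hne := apply_ne_of_sameCycle hα h
    have hcyc : g.IsCycle := ⟨a, hne a, fun y _ => h y⟩
    rw [hcyc.cycleType]
    congr 1
    rw [← Finset.card_univ]
    congr 1
    ext y
    simp [hne y]
  · intro h
    have hcyc : g.IsCycle := by
      rw [← Perm.card_cycleType_eq_one, h]
      simp
    have hsup : g.support = Finset.univ := by
      rw [← Finset.card_eq_iff_eq_univ]
      have := hcyc.cycleType
      rw [h] at this
      exact (Multiset.singleton_inj.1 this).symm
    intro x
    have h1 : ∀ y, g y ≠ y := fun y => by
      rw [← Perm.mem_support, hsup]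
      exact Finset.mem_univ y
    exact hcyc.sameCycle (h1 a) (h1 x)

/-- The convolution of two colouring counts, evaluated on a long cycle. -/
lemma factorial_mul_colouringConv_longCycle (C₁ C₂ : Type*) [AddGroup C₁] [AddGroup C₂] [Finite C₁]
    [Finite C₂] (τ : Perm α) (a : α) (hτ : ∀ x, τ.SameCycle a x) :
    ((Fintype.card α - 1).factorial : ℝ) * colouringConv C₁ C₂ τ =
      ∑ b ∈ Finset.range (Fintype.card α), ((Fintype.card α - 1).choose b : ℝ) * ((-1) ^ b *
        (blockFactor (Nat.card C₁) b (Fintype.card α - b) *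
        blockFactor (Nat.card C₂) b (Fintype.card α - b) *
        (1 + b * (Fintype.card α - b : ℕ) / (Nat.card C₁ * Nat.card C₂)))) := by
  classical
  have hpos : 0 < Fintype.card α := Fintype.card_pos_iff.2 ⟨a⟩
  -- The convolution is a class function and the long cycles form one class of size `(card α - 1)!`.
  -- One-point sets are separate because `cycleType` omits fixed points.
  have e1 : ∑ g : Perm α, (if ∀ x, g.SameCycle a x then 1 else 0) * colouringConv C₁ C₂ g =
      ((Fintype.card α - 1).factorial : ℝ) * colouringConv C₁ C₂ τ := by
    rcases Nat.lt_or_ge (Fintype.card α) 2 with hlt | hge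
    · have h1 : Fintype.card α = 1 := by omega
      have : Subsingleton α := (Fintype.card_le_one_iff_subsingleton.1 h1.le)
      have h2 : Subsingleton (Perm α) := inferInstance
      have hu : (Finset.univ : Finset (Perm α)) = {τ} := by
        ext g
        simp only [Finset.mem_univ, Finset.mem_singleton, true_iff]
        exact Subsingleton.elim g τ
      rw [hu, Finset.sum_singleton, if_pos hτ, h1]
      simp
    · have hcount := Perm.card_of_cycleType_singleton (α := α) hge le_rfl
      rw [Nat.choose_self, mul_one] at hcount
      simp only [ite_mul, one_mul, zero_mul]
      rw [← Finset.sum_filter]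
      have : ∀ g ∈ Finset.univ.filter (fun g : Perm α => ∀ x, g.SameCycle a x),
          colouringConv C₁ C₂ g = colouringConv C₁ C₂ τ := by
        intro g hg
        have hg' := (Finset.mem_filter.1 hg).2
        rw [forall_sameCycle_iff_cycleType hge] at hg' hτ
        obtain ⟨c, hc⟩ := isConj_iff.1 (Perm.isConj_iff_cycleType_eq.2 (hτ.trans hg'.symm))
        rw [← hc, colouringConv_conj]
      rw [Finset.sum_congr rfl this, Finset.sum_const, nsmul_eq_mul, ← hcount]
      simp only [forall_sameCycle_iff_cycleType hge]
  rw [← e1]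
  simp only [← sum_powerset_restrictSign, Finset.sum_mul]
  rw [Finset.sum_comm]
  have e2 : ∀ S : Finset α, ∑ g : Perm α, (-1) ^ S.card * restrictSign g S * colouringConv C₁ C₂ g =
      (-1) ^ S.card * (blockFactor (Nat.card C₁) S.card (Fintype.card α - S.card) *
        blockFactor (Nat.card C₂) S.card (Fintype.card α - S.card) *
        (1 + S.card * (Fintype.card α - S.card : ℕ) / (Nat.card C₁ * Nat.card C₂))) := by
    intro S
    rw [← sum_blockSign_mul_colouringConv, ← sum_restrictSign_mul, Finset.mul_sum]
    refine Finset.sum_congr rfl fun g _ => ?_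
    ring
  rw [Finset.sum_congr rfl fun S _ => e2 S]
  rw [Finset.sum_powerset_apply_card (fun b => (-1 : ℝ) ^ b *
    (blockFactor (Nat.card C₁) b (Fintype.card α - b) *
        blockFactor (Nat.card C₂) b (Fintype.card α - b) *
        (1 + b * (Fintype.card α - b : ℕ) / (Nat.card C₁ * Nat.card C₂))))]
  rw [Finset.card_erase_of_mem (Finset.mem_univ a), Finset.card_univ,
    Nat.sub_add_cancel hpos]
  simp only [nsmul_eq_mul]

end LongCycles

/-! ### The square case and the moment bound -/

lemma mul_blockFactor_succ (x : ℝ) {k b : ℕ} (hb : b < k) :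
    (x + k - (b + 1)) * blockFactor x (b + 1) (k - (b + 1)) = (x - b) * blockFactor x b (k - b) := by
  unfold blockFactor
  obtain ⟨c, rfl⟩ : ∃ c, k = b + 1 + c := ⟨k - (b + 1), by omega⟩
  rw [show b + 1 + c - (b + 1) = c by omega, show b + 1 + c - b = c + 1 by omega,
    Finset.prod_range_succ, Finset.prod_range_succ]
  push_cast
  ring

/-- For `b > 0`, the product `blockFactor n b (k - b)` contains the factor `n` twice and lacks `n -
b`, compared with the rising factorial starting at `n - b`. -/
lemma mul_ascPochhammer_sub {n : ℕ} (hn : 0 < n) {k b : ℕ} (hb : b < k) :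
    (n : ℝ) * (ascPochhammer ℝ k).eval ((n : ℝ) - b) = (n - b) * blockFactor n b (k - b) := by
  induction b with
  | zero =>
    simp only [Nat.cast_zero, sub_zero, blockFactor, Finset.range_zero, Finset.prod_empty, one_mul,
      Nat.sub_zero]
    congr 1
    clear hb
    induction k with
    | zero => simp
    | succ k ih => rw [ascPochhammer_eval_succ_right, ih, Finset.prod_range_succ]
  | succ b ih =>
    have ih := ih (by omega)
    have h1 : ((n : ℝ) - (b + 1)) * (ascPochhammer ℝ k).eval ((n : ℝ) - b) =
        (ascPochhammer ℝ k).eval ((n : ℝ) - (b + 1)) * (n - (b + 1) + k) := by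
      rw [← ascPochhammer_eval_succ_right, ascPochhammer_eval_succ_left]
      congr 3
      ring
    have h2 := mul_blockFactor_succ (n : ℝ) (show b < k by omega)
    have hbk : (b : ℝ) + 1 ≤ k := by exact_mod_cast hb.le
    have hn' : (0 : ℝ) < n := by exact_mod_cast hn
    have hne : (n : ℝ) + k - (b + 1) ≠ 0 := by linarith
    refine mul_left_cancel₀ hne ?_
    push_cast
    linear_combination (-(n : ℝ)) * h1 + ((n : ℝ) - (b + 1)) * ih - ((n : ℝ) - (b + 1)) * h2

section Bound

variable {α : Type*} [Fintype α] [DecidableEq α]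

/-- The square case in closed form. -/
lemma card_mul_colouringConv_longCycle {n : ℕ} (hn : 0 < n) (τ : Perm α) (a : α)
    (hτ : ∀ x, τ.SameCycle a x) :
    (Fintype.card α : ℝ) * colouringConv (Fin n) (Fin n) τ = hookSum n (Fintype.card α) := by
  have : NeZero n := ⟨hn.ne'⟩
  have h := factorial_mul_colouringConv_longCycle (Fin n) (Fin n) τ a hτ
  have hpos : 0 < Fintype.card α := Fintype.card_pos_iff.2 ⟨a⟩
  obtain ⟨r, hr⟩ : ∃ r, Fintype.card α = r + 1 := ⟨Fintype.card α - 1, by omega⟩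
  rw [hr] at h ⊢
  simp only [Nat.card_fin, Nat.add_sub_cancel] at h
  have hn' : (n : ℝ) ≠ 0 := by exact_mod_cast hn.ne'
  set A : ℕ → ℝ := fun b => blockFactor n b (r + 1 - b) / n with hA
  -- Telescoping certificate between the hook sum and the block formula. It vanishes at `0` through
  -- the factor `b`, and at `r + 1` through the binomial coefficient.
  set Z : ℕ → ℝ := fun b => (-1) ^ b * (b * (r.choose b : ℝ)) * ((n + (r + 1) - b) * A b) ^ 2 with hZ
  have hhook : (r.factorial : ℝ) * hookSum n (r + 1) =
      ∑ b ∈ Finset.range (r + 1), (-1) ^ b * (r.choose b : ℝ) * ((n - b) * A b) ^ 2 := by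
    rw [hookSum, Finset.mul_sum]
    refine Finset.sum_congr rfl fun b hb => ?_
    have hb' : b < r + 1 := Finset.mem_range.1 hb
    have h1 := mul_ascPochhammer_sub hn hb'
    have h2 : ((n : ℝ) - b) * A b = (ascPochhammer ℝ (r + 1)).eval ((n : ℝ) - b) := by
      simp only [hA]
      field_simp
      linarith
    rw [h2, Nat.cast_choose ℝ (Nat.lt_succ_iff.1 hb')]
    simp only [Nat.add_sub_cancel]
    ring
  have htel : ∀ b ∈ Finset.range (r + 1), (-1) ^ b * (r.choose b : ℝ) * ((n - b) * A b) ^ 2 -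
      (r + 1) * ((r.choose b : ℝ) * ((-1) ^ b *
        (blockFactor n b (r + 1 - b) * blockFactor n b (r + 1 - b) *
        (1 + b * (r + 1 - b : ℕ) / ((n : ℝ) * n))))) = Z (b + 1) - Z b := by
    intro b hb
    have hb' : b < r + 1 := Finset.mem_range.1 hb
    have h1 : ((n : ℝ) + (r + 1) - (b + 1 : ℕ)) * A (b + 1) = (n - b) * A b := by
      have := mul_blockFactor_succ (n : ℝ) hb'
      simp only [hA]
      push_cast at this ⊢
      rw [mul_div_assoc', mul_div_assoc', this]
    have h2 : ((b + 1 : ℕ) : ℝ) * (r.choose (b + 1) : ℝ) = (r - b) * (r.choose b : ℝ) := by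
      have := Nat.choose_succ_right_eq r b
      have hsub : ((r - b : ℕ) : ℝ) = r - b := Nat.cast_sub (Nat.lt_succ_iff.1 hb')
      rw [← hsub]
      exact_mod_cast (by linarith : (b + 1) * r.choose (b + 1) = (r - b) * r.choose b)
    have h3 : blockFactor n b (r + 1 - b) = n * A b := by
      simp only [hA]
      field_simp
    have h4 : ((r + 1 - b : ℕ) : ℝ) = r + 1 - b := by
      rw [Nat.cast_sub hb'.le]
      push_cast
      ring
    simp only [hZ]
    rw [h1, h2, h3, h4]
    field_simp
    ring
  have hsum := Finset.sum_congr rfl htel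
  rw [Finset.sum_range_sub, Finset.sum_sub_distrib, ← Finset.mul_sum, ← hhook, ← h] at hsum
  have hZ0 : Z 0 = 0 := by simp [hZ]
  have hZr : Z (r + 1) = 0 := by simp [hZ]
  rw [hZ0, hZr] at hsum
  have hf : (r.factorial : ℝ) ≠ 0 := by exact_mod_cast Nat.factorial_ne_zero r
  refine mul_left_cancel₀ hf ?_
  push_cast
  linarith

/-- The bound on the genus expansion of trace moments. -/
lemma colouringConv_longCycle_le {m n : ℕ} (hm : 0 < m) (hmn : m ≤ n) (τ : Perm α) (a : α)
    (hτ : ∀ x, τ.SameCycle a x) (hk : (Fintype.card α : ℝ) ^ 3 ≤ 16 * (n : ℝ) ^ 2) :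
    colouringConv (Fin n) (Fin m) τ ≤ 4 ^ Fintype.card α * m * (n : ℝ) ^ Fintype.card α := by
  have hn : 0 < n := by omega
  have hn' : (0 : ℝ) < n := by exact_mod_cast hn
  have hpos : (0 : ℝ) < Fintype.card α := by exact_mod_cast Fintype.card_pos_iff.2 ⟨a⟩
  have : Nonempty α := ⟨a⟩
  have h1 : (n : ℝ) * colouringConv (Fin n) (Fin m) τ ≤ m * colouringConv (Fin n) (Fin n) τ := by
    unfold colouringConv
    rw [Finset.mul_sum, Finset.mul_sum]
    refine Finset.sum_le_sum fun σ _ => ?_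
    have : (n : ℝ) * colouringCount (Fin m) (τ * σ) ≤ m * colouringCount (Fin n) (τ * σ) := by
      exact_mod_cast mul_colouringCount_le hmn (τ * σ)
    have h0 : (0 : ℝ) ≤ colouringCount (Fin n) σ := by positivity
    nlinarith
  have h2 := (hookSum_nonneg_le n hn _ hk).2
  rw [← card_mul_colouringConv_longCycle hn τ a hτ, mul_assoc, mul_le_mul_iff_right₀ hpos] at h2
  refine le_of_mul_le_mul_left (h1.trans ?_) hn'
  calc (m : ℝ) * colouringConv (Fin n) (Fin n) τ
      ≤ m * (4 ^ Fintype.card α * (n : ℝ) ^ (Fintype.card α + 1)) := by gcongr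
    _ = _ := by ring

end Bound

/-! ### Wick's formula, for Gaussian weights and on the sphere -/

/-- Moments of the standard complex Gaussian weight. -/
lemma integral_complex_pow_mul_star_pow (a b : ℕ) :
    ∫ z : ℂ, z ^ a * star z ^ b * (Real.exp (-‖z‖ ^ 2) : ℂ) =
      if a = b then (Real.pi * a.factorial : ℂ) else 0 := by
  split_ifs with hab
  · subst hab
    have h := Complex.integral_rpow_mul_exp_neg_rpow (p := 2) (q := 2 * a) (by norm_num)
      (by have : (0 : ℝ) ≤ a := by positivity
          linarith)
    have e : ∀ z : ℂ, z ^ a * star z ^ a * (Real.exp (-‖z‖ ^ 2) : ℂ) =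
        ((‖z‖ ^ (2 * (a : ℝ)) * Real.exp (-‖z‖ ^ (2 : ℝ)) : ℝ) : ℂ) := by
      intro z
      rw [← mul_pow, Complex.star_def, Complex.mul_conj, Complex.normSq_eq_norm_sq]
      rw [show (2 * (a : ℝ)) = ((2 * a : ℕ) : ℝ) by push_cast; ring, Real.rpow_natCast,
        show (2 : ℝ) = ((2 : ℕ) : ℝ) by norm_num, Real.rpow_natCast]
      push_cast
      rw [pow_mul]
    simp only [e]
    rw [integral_complex_ofReal, h]
    rw [show (2 * (a : ℝ) + 2) / 2 = a + 1 by ring, Real.Gamma_nat_eq_factorial]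
    push_cast
    ring
  · set I := ∫ z : ℂ, z ^ a * star z ^ b * (Real.exp (-‖z‖ ^ 2) : ℂ) with hI
    -- Rotation invariance of the weight multiplies the integral by `c ^ a * star c ^ b`.
    have hrot : ∀ c : Circle, I = (c : ℂ) ^ a * star (c : ℂ) ^ b * I := by
      intro c
      have hmp : MeasurePreserving (rotation c) := (rotation c).measurePreserving
      conv_lhs => rw [hI, ← hmp.integral_comp (rotation c).toHomeomorph.measurableEmbedding]
      rw [hI, ← integral_const_mul]
      refine integral_congr_ae (Filter.Eventually.of_forall fun z => ?_)
      simp only [rotation_apply, star_mul', mul_pow, norm_mul, Circle.norm_coe, one_mul]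
      ring
    by_contra hne
    have h1 := hrot (Circle.exp 1)
    have h2 : (Circle.exp 1 : ℂ) ^ a * star (Circle.exp 1 : ℂ) ^ b = 1 := by
      have := mul_right_cancel₀ hne (h1.symm.trans (one_mul I).symm)
      exact this
    have h3 : (Circle.exp 1) ^ a = (Circle.exp 1) ^ b := by
      apply Subtype.ext
      have hu : star (Circle.exp 1 : ℂ) * (Circle.exp 1 : ℂ) = 1 := by
        rw [mul_comm, Complex.star_def, Complex.mul_conj, Circle.normSq_coe]
        simp
      rw [Circle.coe_pow, Circle.coe_pow]
      calc (Circle.exp 1 : ℂ) ^ a = (Circle.exp 1 : ℂ) ^ a *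
            (star (Circle.exp 1 : ℂ) * (Circle.exp 1 : ℂ)) ^ b := by rw [hu]; simp
        _ = ((Circle.exp 1 : ℂ) ^ a * star (Circle.exp 1 : ℂ) ^ b) * (Circle.exp 1 : ℂ) ^ b := by
            rw [mul_pow]; ring
        _ = _ := by rw [h2, one_mul]
    have h4 : Circle.exp (a : ℝ) = Circle.exp (b : ℝ) := by
      have hn : ∀ n : ℕ, Circle.exp (n : ℝ) = (Circle.exp 1) ^ n := by
        intro n
        apply Subtype.ext
        rw [Circle.coe_pow, Circle.coe_exp, Circle.coe_exp, ← Complex.exp_nat_mul]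
        simp
      rw [hn, hn, h3]
    rw [Circle.exp_eq_exp] at h4
    obtain ⟨m, hm⟩ := h4
    -- Rotation by one radian suffices: `a - b = 2πm` with `m ≠ 0` would make `π` rational.
    have hm0 : m = 0 := by
      by_contra hm0
      refine irrational_pi ⟨((a : ℚ) - b) / (2 * m), ?_⟩
      have : (m : ℝ) ≠ 0 := by exact_mod_cast hm0
      push_cast
      field_simp
      linarith
    rw [hm0] at hm
    apply hab
    have : (a : ℝ) = b := by simpa using hm
    exact_mod_cast this

section Wick

variable {L ι : Type*} [Fintype L] [DecidableEq L] [Fintype ι] [DecidableEq ι]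

/-- If the fibres of `u` and `w` have equal sizes, the solutions form a coset of the stabilizer of
`u`, whose order is a product of factorials; otherwise there are none. This matches the product of
one-variable Gaussian moments. -/
lemma card_perm_comp_eq (u w : L → ι) :
    (Nat.card {σ : Perm L // ∀ l, w (σ l) = u l} : ℂ) =
      ∏ i, if (Finset.univ.filter fun l => u l = i).card = (Finset.univ.filter fun l => w l = i).card
        then ((Finset.univ.filter fun l => u l = i).card.factorial : ℂ) else 0 := by
  by_cases h : ∀ i, (Finset.univ.filter fun l => u l = i).card =
      (Finset.univ.filter fun l => w l = i).card
  · have e : ∀ i, Nonempty ({l // u l = i} ≃ {l // w l = i}) := by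
      intro i
      rw [← Fintype.card_eq, Fintype.card_subtype, Fintype.card_subtype]
      exact h i
    obtain ⟨σ₀, h0⟩ : ∃ σ₀ : Perm L, ∀ l, w (σ₀ l) = u l :=
      ⟨Equiv.ofFiberEquiv fun i => (e i).some, fun l => Equiv.ofFiberEquiv_map _ l⟩
    have hcard : Nat.card {σ : Perm L // ∀ l, w (σ l) = u l} =
        Nat.card {g : Perm L // u ∘ g = u} := by
      refine Nat.card_congr ((Equiv.mulLeft σ₀⁻¹).subtypeEquiv fun σ => ?_)
      rw [funext_iff]
      refine forall_congr' fun l => ?_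
      have hl : u ((σ₀⁻¹ * σ) l) = w (σ l) := by
        rw [← h0]
        simp
      rw [Function.comp_apply, Equiv.coe_mulLeft, hl]
    rw [hcard, Nat.card_eq_fintype_card, DomMulAct.stabilizer_card]
    push_cast
    refine Finset.prod_congr rfl fun i _ => ?_
    rw [if_pos (h i), Fintype.card_subtype]
  · have hemp : IsEmpty {σ : Perm L // ∀ l, w (σ l) = u l} := by
      refine ⟨fun σ => h fun i => ?_⟩
      refine Finset.card_bij (fun l _ => σ.1 l) ?_ ?_ ?_
      · intro l hl
        simpa [σ.2 l] using hl
      · intro l _ l' _ hll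
        exact σ.1.injective hll
      · intro l hl
        refine ⟨σ.1⁻¹ l, ?_, by simp⟩
        have := σ.2 (σ.1⁻¹ l)
        simp only [Finset.mem_filter, Finset.mem_univ, true_and] at hl ⊢
        rw [← this, ← hl]
        simp
    push Not at h
    obtain ⟨i, hi⟩ := h
    rw [Nat.card_of_isEmpty, Finset.prod_eq_zero (Finset.mem_univ i) (if_neg hi)]
    simp

/-- Wick's formula for the Gaussian weight in coordinates. -/
lemma integral_pi_wick (u w : L → ι) :
    ∫ z : ι → ℂ, (∏ l, z (u l) * star (z (w l))) * (Real.exp (-∑ i, ‖z i‖ ^ 2) : ℂ) =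
      (Real.pi : ℂ) ^ Fintype.card ι * Nat.card {σ : Perm L // ∀ l, w (σ l) = u l} := by
  have e : ∀ z : ι → ℂ, (∏ l, z (u l) * star (z (w l))) * (Real.exp (-∑ i, ‖z i‖ ^ 2) : ℂ) =
      ∏ i, (z i ^ (Finset.univ.filter fun l => u l = i).card *
        star (z i) ^ (Finset.univ.filter fun l => w l = i).card *
        (Real.exp (-‖z i‖ ^ 2) : ℂ)) := by
    intro z
    rw [Finset.prod_mul_distrib, Finset.prod_mul_distrib, Finset.prod_mul_distrib,
      ← Finset.sum_neg_distrib, Real.exp_sum]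
    push_cast
    congr 2
    · rw [← Finset.prod_fiberwise (s := Finset.univ) (g := u)]
      refine Finset.prod_congr rfl fun i _ => ?_
      rw [Finset.prod_congr rfl (g := fun _ => z i), Finset.prod_const]
      intro l hl
      rw [(Finset.mem_filter.1 hl).2]
    · rw [← Finset.prod_fiberwise (s := Finset.univ) (g := w)]
      refine Finset.prod_congr rfl fun i _ => ?_
      rw [Finset.prod_congr rfl (g := fun _ => star (z i)), Finset.prod_const]
      intro l hl
      rw [(Finset.mem_filter.1 hl).2]
  simp only [e]
  rw [integral_fintype_prod_volume_eq_prod (fun i (x : ℂ) =>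
    x ^ (Finset.univ.filter fun l => u l = i).card *
        star x ^ (Finset.univ.filter fun l => w l = i).card * (Real.exp (-‖x‖ ^ 2) : ℂ)),
    card_perm_comp_eq, ← Finset.card_univ, ← Finset.prod_const, ← Finset.prod_mul_distrib]
  refine Finset.prod_congr rfl fun i _ => ?_
  rw [integral_complex_pow_mul_star_pow]
  split_ifs <;> simp

end Wick

/-- Gaussian averages of homogeneous functions in polar coordinates. -/
lemma integral_homogeneous_mul_exp {E : Type*} [NormedAddCommGroup E] [NormedSpace ℝ E]
    [MeasurableSpace E] [Nontrivial E] (μ : Measure E) [FiniteDimensional ℝ E] [BorelSpace E]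
    [μ.IsAddHaarMeasure] (d : ℕ) : ∃ c : ℂ, ∀ f : E → ℂ,
      (∀ (r : ℝ) (x : E), 0 < r → f (r • x) = (r : ℂ) ^ d * f x) →
      ∫ x, f x * (Real.exp (-‖x‖ ^ 2) : ℂ) ∂μ = c * ∫ ψ : Metric.sphere (0 : E) 1, f ψ ∂μ.toSphere := by
  -- The radial integral depends on the degree only, which allows all monomials of one degree to
  -- share the constant.
  refine ⟨∫ r : Set.Ioi (0 : ℝ), ((r : ℝ) : ℂ) ^ d * (Real.exp (-(r : ℝ) ^ 2) : ℂ)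
    ∂(Measure.volumeIoiPow (Module.finrank ℝ E - 1)), fun f hf => ?_⟩
  set F : E → ℂ := fun x => f x * (Real.exp (-‖x‖ ^ 2) : ℂ) with hF
  calc ∫ x, F x ∂μ = ∫ x : ({(0)}ᶜ : Set E), F x.1 ∂(μ.comap (↑)) := by
        rw [integral_subtype_comap (measurableSet_singleton _).compl F,
          restrict_compl_singleton]
    _ = ∫ x : Metric.sphere (0 : E) 1 × Set.Ioi (0 : ℝ),
        f x.1 * (((x.2 : ℝ) : ℂ) ^ d * (Real.exp (-(x.2 : ℝ) ^ 2) : ℂ))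
        ∂μ.toSphere.prod (.volumeIoiPow (Module.finrank ℝ E - 1)) := by
      rw [← μ.measurePreserving_homeomorphUnitSphereProd.integral_comp
        (Homeomorph.measurableEmbedding _)]
      refine integral_congr_ae (Filter.Eventually.of_forall fun x => ?_)
      have hx : 0 < ‖x.1‖ := norm_pos_iff.2 x.2
      simp only [hF, homeomorphUnitSphereProd_apply_fst_coe,
        homeomorphUnitSphereProd_apply_snd_coe]
      have : f x.1 = (‖x.1‖ : ℂ) ^ d * f (‖x.1‖⁻¹ • x.1) := by
        rw [← hf _ _ hx, smul_smul, mul_inv_cancel₀ hx.ne', one_smul]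
      rw [this]
      ring
    _ = _ := by
      rw [integral_prod_mul (fun ψ : Metric.sphere (0 : E) 1 => f ψ)
        (fun r : Set.Ioi (0 : ℝ) => ((r : ℝ) : ℂ) ^ d * (Real.exp (-(r : ℝ) ^ 2) : ℂ)), mul_comm]

lemma integral_euclideanSpace_eq_smul_pi (ι : Type) [Fintype ι] : ∃ c : ℂ, c ≠ 0 ∧
    ∀ F : EuclideanSpace ℂ ι → ℂ, ∫ x, F x = c * ∫ z : ι → ℂ, F (WithLp.toLp 2 z) := by
  set T := (PiLp.continuousLinearEquiv 2 ℝ (fun _ : ι => ℂ)).symm with hT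
  set μ' : Measure (EuclideanSpace ℂ ι) := Measure.map T (volume : Measure (ι → ℂ)) with hμ'
  have : μ'.IsAddHaarMeasure := T.isAddHaarMeasure_map volume
  have h := Measure.isAddLeftInvariant_eq_smul (volume : Measure (EuclideanSpace ℂ ι)) μ'
  set c := (volume : Measure (EuclideanSpace ℂ ι)).addHaarScalarFactor μ'
  refine ⟨(c : ℝ), ?_, fun F => ?_⟩
  · intro hc
    have hc' : c = 0 := by exact_mod_cast hc
    rw [hc', zero_smul] at h
    exact (NeZero.ne (volume : Measure (EuclideanSpace ℂ ι))) h
  · have e : ∫ x, F x ∂μ' = ∫ z : ι → ℂ, F (T z) :=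
      T.toHomeomorph.measurableEmbedding.integral_map F
    rw [h, integral_smul_nnreal_measure, e, NNReal.smul_def, Complex.real_smul]
    rfl

lemma integral_gaussian_wick (ι : Type) [Fintype ι] [DecidableEq ι] : ∃ c : ℂ, c ≠ 0 ∧
    ∀ (L : Type) [Fintype L] [DecidableEq L] (u w : L → ι),
    ∫ x : EuclideanSpace ℂ ι, (∏ l, x (u l) * star (x (w l))) * (Real.exp (-‖x‖ ^ 2) : ℂ) =
      c * Nat.card {σ : Perm L // ∀ l, w (σ l) = u l} := by
  obtain ⟨c, hc, h⟩ := integral_euclideanSpace_eq_smul_pi ι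
  refine ⟨c * (Real.pi : ℂ) ^ Fintype.card ι, mul_ne_zero hc (pow_ne_zero _ ?_), ?_⟩
  · exact_mod_cast Real.pi_ne_zero
  · intro L _ _ u w
    rw [h, mul_assoc, ← integral_pi_wick]
    simp only [EuclideanSpace.norm_sq_eq]

lemma sum_card_stabilizer (L ι : Type) [Fintype L] [DecidableEq L] [Fintype ι] [DecidableEq ι] :
    ∑ u : L → ι, Nat.card {σ : Perm L // ∀ l, u (σ l) = u l} =
      ∑ σ : Perm L, colouringCount ι σ := by
  unfold colouringCount
  rw [← Nat.card_sigma, ← Nat.card_sigma]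
  exact Nat.card_congr
    { toFun := fun s => ⟨s.2.1, s.1, s.2.2⟩
      invFun := fun s => ⟨s.2.1, s.1, s.2.2⟩
      left_inv := fun _ => rfl
      right_inv := fun _ => rfl }

lemma sum_prod_mul_star (L ι : Type) [Fintype L] [DecidableEq L] [Fintype ι]
    (x : EuclideanSpace ℂ ι) :
    ∑ u : L → ι, ∏ l, x (u l) * star (x (u l)) = ((‖x‖ ^ 2 : ℝ) : ℂ) ^ Fintype.card L := by
  classical
  have h : ((‖x‖ ^ 2 : ℝ) : ℂ) = ∑ i, x i * star (x i) := by
    rw [EuclideanSpace.norm_sq_eq]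
    push_cast
    refine Finset.sum_congr rfl fun i _ => ?_
    rw [Complex.star_def, Complex.mul_conj, Complex.normSq_eq_norm_sq]
    push_cast
    rfl
  rw [h, ← Finset.card_univ, ← Finset.prod_const, Finset.prod_univ_sum]
  simp

/-- Wick's formula for the normalized uniform measure on the sphere. -/
lemma integral_uniformMeasure_wick (L ι : Type) [Fintype L] [DecidableEq L] [Fintype ι]
    [DecidableEq ι] [Nonempty ι] (u w : L → ι) :
    (∏ i ∈ Finset.range (Fintype.card L), ((Fintype.card ι : ℂ) + i)) *
      ∫ ψ, ∏ l, ψ.1 (u l) * star (ψ.1 (w l)) ∂(uniformMeasure ι) =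
      Nat.card {σ : Perm L // ∀ l, w (σ l) = u l} := by
  obtain ⟨c, hc, hG⟩ := integral_gaussian_wick ι
  have hnt : Nontrivial (EuclideanSpace ℂ ι) := by
    obtain ⟨i⟩ := ‹Nonempty ι›
    exact ⟨EuclideanSpace.single i 1, 0, by simp⟩
  obtain ⟨p, hp⟩ := integral_homogeneous_mul_exp (volume : Measure (EuclideanSpace ℂ ι))
    (2 * Fintype.card L)
  have hhom : ∀ v v' : L → ι, ∀ (r : ℝ) (x : EuclideanSpace ℂ ι), 0 < r →
      ∏ l, (r • x) (v l) * star ((r • x) (v' l)) =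
        (r : ℂ) ^ (2 * Fintype.card L) * ∏ l, x (v l) * star (x (v' l)) := by
    intro v v' r x _
    rw [pow_mul, ← Finset.card_univ, ← Finset.prod_const, ← Finset.prod_mul_distrib]
    refine Finset.prod_congr rfl fun l _ => ?_
    simp only [PiLp.smul_apply, Complex.real_smul, star_mul', Complex.star_def, Complex.conj_ofReal]
    ring
  have hpol : ∀ v v' : L → ι, c * Nat.card {σ : Perm L // ∀ l, v' (σ l) = v l} =
      p * ∫ ψ : PureState ι, ∏ l, ψ.1 (v l) * star (ψ.1 (v' l))
        ∂(volume : Measure (EuclideanSpace ℂ ι)).toSphere := by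
    intro v v'
    rw [← hG, hp _ (hhom v v')]
  set S := (volume : Measure (EuclideanSpace ℂ ι)).toSphere with hS
  -- The unknown constants are fixed by summing the diagonal case `u = w` over all `u`: on the
  -- sphere the integrands add up to `1`, and the counts add up to the rising factorial.
  have hnorm : c * ∏ i ∈ Finset.range (Fintype.card L), ((Fintype.card ι : ℂ) + i) =
      p * (S.real Set.univ : ℂ) := by
    have h1 : (∏ i ∈ Finset.range (Fintype.card L), ((Fintype.card ι : ℂ) + i)) =
        ((∑ u : L → ι, Nat.card {σ : Perm L // ∀ l, u (σ l) = u l} : ℕ) : ℂ) := by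
      have := sum_sign_pow_mul_colouringCount ι 0 L
      simp only [pow_zero, one_mul, Nat.card_eq_fintype_card] at this
      rw [sum_card_stabilizer]
      have h2 := congrArg (fun x : ℝ => (x : ℂ)) this
      push_cast at h2 ⊢
      exact h2.symm
    -- A non-integrable function would have integral `0`, but the count on the other side includes
    -- the identity.
    have hint : ∀ v : L → ι, Integrable (fun ψ : PureState ι =>
        ∏ l, ψ.1 (v l) * star (ψ.1 (v l))) S := by
      intro v
      by_contra hni
      have h3 := hpol v v
      rw [integral_undef hni, mul_zero, mul_eq_zero] at h3
      rcases h3 with h3 | h3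
      · exact hc h3
      · have : Nonempty {σ : Perm L // ∀ l, v (σ l) = v l} := ⟨⟨1, fun l => rfl⟩⟩
        have h4 : 0 < Nat.card {σ : Perm L // ∀ l, v (σ l) = v l} := Nat.card_pos
        have h5 : Nat.card {σ : Perm L // ∀ l, v (σ l) = v l} = 0 := by exact_mod_cast h3
        omega
    rw [h1]
    push_cast
    rw [Finset.mul_sum, Finset.sum_congr rfl fun v _ => hpol v v, ← Finset.mul_sum,
      ← integral_finsetSum _ fun v _ => hint v]
    congr 1
    have h6 : ∀ ψ : PureState ι, ∑ v : L → ι, ∏ l, ψ.1 (v l) * star (ψ.1 (v l)) = 1 := by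
      intro ψ
      rw [sum_prod_mul_star, mem_sphere_zero_iff_norm.1 ψ.2]
      simp
    simp only [h6]
    rw [integral_const]
    simp
  have hprod : (∏ i ∈ Finset.range (Fintype.card L), ((Fintype.card ι : ℂ) + i)) ≠ 0 := by
    rw [Finset.prod_ne_zero_iff]
    intro i _
    have : 0 < Fintype.card ι := Fintype.card_pos
    exact_mod_cast (by omega : Fintype.card ι + i ≠ 0)
  have hS0 : (S.real Set.univ : ℂ) ≠ 0 := fun h0 => by
    rw [h0, mul_zero] at hnorm
    exact (mul_ne_zero hc hprod) hnorm
  have hmain := hpol u w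
  unfold uniformMeasure
  rw [integral_smul_measure]
  rw [← hS, ENNReal.toReal_inv, Complex.real_smul]
  rw [show (S Set.univ).toReal = S.real Set.univ from rfl]
  refine mul_left_cancel₀ hc ?_
  rw [hmain, ← mul_assoc, hnorm]
  push_cast
  field_simp

/-! ### Moments of the reduced state -/

/-- The arbitrary weight `h` on the endpoints lets the induction absorb the first step of the walk
into the weight; the trace formula closes the walk by taking `h i j = M j i`. -/
lemma sum_walk_eq {n : Type*} [Fintype n] [DecidableEq n] (M : Matrix n n ℂ) (r : ℕ)
    (h : n → n → ℂ) :
    ∑ a : Fin (r + 1) → n, h (a 0) (a (Fin.last r)) * ∏ l : Fin r, M (a l.castSucc) (a l.succ) =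
      ∑ i, ∑ j, h i j * (M ^ r) i j := by
  induction r generalizing h with
  | zero =>
    rw [← (Equiv.funUnique (Fin 1) n).symm.sum_comp]
    simp [Matrix.one_apply]
  | succ r ih =>
    rw [← (Fin.consEquiv fun _ => n).sum_comp, Fintype.sum_prod_type, Finset.sum_comm]
    have e : ∀ (a : Fin (r + 1) → n), ∑ i, h ((Fin.consEquiv fun _ => n) (i, a) 0)
        ((Fin.consEquiv fun _ => n) (i, a) (Fin.last (r + 1))) *
        ∏ l : Fin (r + 1), M ((Fin.consEquiv fun _ => n) (i, a) l.castSucc)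
          ((Fin.consEquiv fun _ => n) (i, a) l.succ) =
        (fun x y => ∑ i, h i y * M i x) (a 0) (a (Fin.last r)) *
          ∏ l : Fin r, M (a l.castSucc) (a l.succ) := by
      intro a
      rw [Finset.sum_mul]
      refine Finset.sum_congr rfl fun i _ => ?_
      rw [Fin.prod_univ_succ]
      simp only [Fin.consEquiv_apply, Fin.cons_zero, Fin.castSucc_zero, Fin.cons_succ,
        ← Fin.succ_last, ← Fin.succ_castSucc]
      ring
    refine (Finset.sum_congr rfl fun a _ => e a).trans ((ih fun x y => ∑ i, h i y * M i x).trans ?_)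
    simp only [pow_succ', Matrix.mul_apply, Finset.mul_sum, Finset.sum_mul]
    have : ∀ x : n, ∑ j, ∑ i, h i j * M i x * (M ^ r) x j =
        ∑ i, ∑ j, h i j * (M i x * (M ^ r) x j) := by
      intro x
      rw [Finset.sum_comm]
      simp only [mul_assoc]
    simp only [this]
    rw [Finset.sum_comm]
    exact Finset.sum_congr rfl fun i _ => Finset.sum_comm

lemma trace_pow_eq_sum {n : Type*} [Fintype n] [DecidableEq n] (M : Matrix n n ℂ) (r : ℕ) :
    (M ^ (r + 1)).trace = ∑ a : Fin (r + 1) → n, ∏ l, M (a l) (a (finRotate (r + 1) l)) := by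
  have h := sum_walk_eq M r (fun i j => M j i)
  have e : ∀ a : Fin (r + 1) → n, ∏ l, M (a l) (a (finRotate (r + 1) l)) =
      M (a (Fin.last r)) (a 0) * ∏ l : Fin r, M (a l.castSucc) (a l.succ) := by
    intro a
    rw [Fin.prod_univ_castSucc, mul_comm]
    simp [Fin.coeSucc_eq_succ]
  rw [Finset.sum_congr rfl fun a _ => e a, h, pow_succ, Matrix.trace]
  simp only [Matrix.diag_apply, Matrix.mul_apply, mul_comm]

lemma finRotate_sameCycle (r : ℕ) (x : Fin (r + 1)) : (finRotate (r + 1)).SameCycle 0 x := by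
  refine ⟨(x : ℕ), ?_⟩
  have : ∀ j : ℕ, ((finRotate (r + 1)) ^ j) 0 = Fin.ofNat (r + 1) j := by
    intro j
    induction j with
    | zero => simp
    | succ j ih =>
      rw [pow_succ', Perm.mul_apply, ih, finRotate_apply]
      ext
      simp [Fin.val_add]
  rw [zpow_natCast, this]
  ext
  simp

/-- The trace of a power of the reduced density matrix as a polynomial in the coordinates. -/
noncomputable def tracePowPoly (dA dB r : ℕ) :
    MvPolynomial ((Fin dA × Fin dB) ⊕ (Fin dA × Fin dB)) ℂ :=
  ∑ a : Fin (r + 1) → Fin dA, ∑ b : Fin (r + 1) → Fin dB, ∏ l,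
    (MvPolynomial.X (Sum.inl (a l, b l)) *
      MvPolynomial.X (Sum.inr (a (finRotate (r + 1) l), b l)))

lemma isBihomogeneous_tracePowPoly (dA dB r : ℕ) :
    IsBihomogeneous (r + 1) (tracePowPoly dA dB r) := by
  have key : ∀ w : (Fin dA × Fin dB) ⊕ (Fin dA × Fin dB) → ℕ,
      (∀ i j, w (Sum.inl i) + w (Sum.inr j) = 1) →
      (tracePowPoly dA dB r).IsWeightedHomogeneous w (r + 1) := by
    intro w hw
    refine MvPolynomial.IsWeightedHomogeneous.sum _ _ _ fun a _ =>
      MvPolynomial.IsWeightedHomogeneous.sum _ _ _ fun b _ => ?_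
    have := MvPolynomial.IsWeightedHomogeneous.prod Finset.univ
      (fun l => (MvPolynomial.X (Sum.inl (a l, b l)) *
        MvPolynomial.X (Sum.inr (a (finRotate (r + 1) l), b l)) :
        MvPolynomial ((Fin dA × Fin dB) ⊕ (Fin dA × Fin dB)) ℂ)) (fun _ => 1) (w := w)
      (fun l _ => by
        have h := (MvPolynomial.isWeightedHomogeneous_X ℂ w (Sum.inl (a l, b l))).mul
          (MvPolynomial.isWeightedHomogeneous_X ℂ w
            (Sum.inr (a (finRotate (r + 1) l), b l)))
        rwa [hw] at h)
    simpa using this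
  exact ⟨key _ (by simp), key _ (by simp)⟩

lemma evalState_tracePowPoly {dA dB : ℕ} (r : ℕ) (ψ : BipartiteSpace dA dB) :
    evalState (tracePowPoly dA dB r) ψ = (reducedDensity ψ ^ (r + 1)).trace := by
  rw [trace_pow_eq_sum]
  simp only [evalState, tracePowPoly, map_sum, map_prod, map_mul, MvPolynomial.eval_X,
    Sum.elim_inl, Sum.elim_inr]
  refine Finset.sum_congr rfl fun a _ => ?_
  simp only [reducedDensity, partialTraceB, ketBra, Matrix.of_apply]
  rw [Finset.prod_univ_sum]
  simp

lemma continuous_evalState {ι : Type} [Fintype ι] (p : MvPolynomial (ι ⊕ ι) ℂ) :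
    Continuous fun ψ : PureState ι => evalState p ψ.1 := by
  unfold evalState
  have : Continuous fun ψ : PureState ι =>
      (Sum.elim (fun i => ψ.1 i) (fun i => star (ψ.1 i)) : ι ⊕ ι → ℂ) := by
    refine continuous_pi fun i => ?_
    rcases i with i | i
    · simp only [Sum.elim_inl]
      fun_prop
    · simp only [Sum.elim_inr]
      fun_prop
  exact (MvPolynomial.continuous_eval p).comp this

lemma integrable_of_continuous_sphere {ι F : Type} [Fintype ι] [NormedAddCommGroup F]
    (μ : Measure (PureState ι)) [IsFiniteMeasure μ] {f : PureState ι → F} (hf : Continuous f) :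
    Integrable f μ :=
  hf.integrable_of_hasCompactSupport (HasCompactSupport.of_compactSpace f)

/-- The uniform average of the trace of a power, as a sum over permutations. -/
lemma prod_mul_integral_tracePowPoly {dA dB : ℕ} (hA : 0 < dA) (hB : 0 < dB) (r : ℕ) :
    (∏ i ∈ Finset.range (r + 1), ((dA * dB : ℂ) + i)) *
      ∫ ψ, evalState (tracePowPoly dA dB r) ψ.1 ∂(uniformMeasure (Fin dA × Fin dB)) =
      (colouringConv (Fin dB) (Fin dA) (finRotate (r + 1)) : ℂ) := by
  have : Nonempty (Fin dA × Fin dB) := ⟨(⟨0, hA⟩, ⟨0, hB⟩)⟩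
  have hnt : Nontrivial (EuclideanSpace ℂ (Fin dA × Fin dB)) := by
    obtain ⟨i⟩ := this
    exact ⟨EuclideanSpace.single i 1, 0, by simp⟩
  have hfin : IsFiniteMeasure (uniformMeasure (Fin dA × Fin dB)) := by
    unfold uniformMeasure
    refine Measure.smul_finite _ (ENNReal.inv_ne_top.2 ?_)
    rw [Measure.measure_univ_ne_zero]
    exact Measure.toSphere_ne_zero _
  have e : ∀ ψ : PureState (Fin dA × Fin dB), evalState (tracePowPoly dA dB r) ψ.1 =
      ∑ a : Fin (r + 1) → Fin dA, ∑ b : Fin (r + 1) → Fin dB,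
        ∏ l, ψ.1 ((fun l => (a l, b l)) l) *
          star (ψ.1 ((fun l => (a (finRotate (r + 1) l), b l)) l)) := by
    intro ψ
    simp only [evalState, tracePowPoly, map_sum, map_prod, map_mul, MvPolynomial.eval_X,
      Sum.elim_inl, Sum.elim_inr]
  have hcont : ∀ (a : Fin (r + 1) → Fin dA) (b : Fin (r + 1) → Fin dB),
      Continuous fun ψ : PureState (Fin dA × Fin dB) => ∏ l, ψ.1 ((fun l => (a l, b l)) l) *
          star (ψ.1 ((fun l => (a (finRotate (r + 1) l), b l)) l)) := by
    intro a b
    fun_prop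
  simp only [e]
  rw [integral_finsetSum _ fun a _ => integrable_of_continuous_sphere _
    (continuous_finsetSum _ fun b _ => hcont a b), Finset.mul_sum]
  have e2 : ∀ a : Fin (r + 1) → Fin dA,
      (∏ i ∈ Finset.range (r + 1), ((dA * dB : ℂ) + i)) *
      ∫ ψ : PureState (Fin dA × Fin dB), ∑ b : Fin (r + 1) → Fin dB,
        ∏ l, ψ.1 ((fun l => (a l, b l)) l) *
          star (ψ.1 ((fun l => (a (finRotate (r + 1) l), b l)) l))
          ∂(uniformMeasure (Fin dA × Fin dB)) =
      ∑ b : Fin (r + 1) → Fin dB, (Nat.card {σ : Perm (Fin (r + 1)) //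
        ∀ l, (a (finRotate (r + 1) (σ l)), b (σ l)) = (a l, b l)} : ℂ) := by
    intro a
    rw [integral_finsetSum _ fun b _ => integrable_of_continuous_sphere _ (hcont a b),
      Finset.mul_sum]
    refine Finset.sum_congr rfl fun b _ => ?_
    have h := integral_uniformMeasure_wick (Fin (r + 1)) (Fin dA × Fin dB)
      (fun l => (a l, b l)) (fun l => (a (finRotate (r + 1) l), b l))
    simp only [Fintype.card_fin, Fintype.card_prod] at h
    push_cast at h
    exact h
  rw [Finset.sum_congr rfl fun a _ => e2 a]
  -- A Wick pairing `σ` contributes when `b` is constant on the cycles of `σ` and `a` on those of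
  -- `τσ`; the count is resummed with `σ` outermost.
  have hcount : ∑ a : Fin (r + 1) → Fin dA, ∑ b : Fin (r + 1) → Fin dB,
      Nat.card {σ : Perm (Fin (r + 1)) //
        ∀ l, (a (finRotate (r + 1) (σ l)), b (σ l)) = (a l, b l)} =
      ∑ σ : Perm (Fin (r + 1)), colouringCount (Fin dB) σ *
        colouringCount (Fin dA) (finRotate (r + 1) * σ) := by
    unfold colouringCount
    simp only [← Nat.card_prod]
    rw [← Fintype.sum_prod_type', ← Nat.card_sigma, ← Nat.card_sigma]
    exact Nat.card_congr
      { toFun := fun s => ⟨s.2.1, ⟨s.1.2, fun l => (Prod.ext_iff.1 (s.2.2 l)).2⟩,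
          ⟨s.1.1, fun l => (Prod.ext_iff.1 (s.2.2 l)).1⟩⟩
        invFun := fun s => ⟨(s.2.2.1, s.2.1.1), s.1, fun l => Prod.ext (s.2.2.2 l) (s.2.1.2 l)⟩
        left_inv := fun _ => rfl
        right_inv := fun _ => rfl }
  unfold colouringConv
  have := congrArg (Nat.cast : ℕ → ℂ) hcount
  push_cast at this ⊢
  exact this

/-- The moment bound for designs. -/
lemma pow_mul_integral_trace_le {dA dB : ℕ} (hA : 0 < dA) (hAB : dA ≤ dB) (r : ℕ)
    (ν : Measure (PureState (Fin dA × Fin dB))) (hν : IsProjectiveDesign (r + 1) ν)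
    (hr : ((r : ℝ) + 1) ^ 3 ≤ 16 * (dB : ℝ) ^ 2) :
    (dA : ℝ) ^ (r + 1) * ∫ ψ, ((reducedDensity ψ.1 ^ (r + 1)).trace).re ∂ν ≤
      4 ^ (r + 1) * dA := by
  have hB : 0 < dB := by omega
  have := hν.1
  have h1 := prod_mul_integral_tracePowPoly hA hB r
  rw [← hν.2 _ (isBihomogeneous_tracePowPoly dA dB r)] at h1
  have h2 := colouringConv_longCycle_le hA hAB (finRotate (r + 1)) 0 (finRotate_sameCycle r)
    (by simpa using hr)
  rw [Fintype.card_fin] at h2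
  have hint : Integrable (fun ψ : PureState (Fin dA × Fin dB) =>
      evalState (tracePowPoly dA dB r) ψ.1) ν :=
    integrable_of_continuous_sphere ν (continuous_evalState _)
  have hre : ∫ ψ, ((reducedDensity ψ.1 ^ (r + 1)).trace).re ∂ν =
      (∫ ψ, evalState (tracePowPoly dA dB r) ψ.1 ∂ν).re := by
    simp only [← evalState_tracePowPoly]
    exact Complex.reCLM.integral_comp_comm hint
  rw [hre]
  set I := ∫ ψ, evalState (tracePowPoly dA dB r) ψ.1 ∂ν
  set N : ℝ := ∏ i ∈ Finset.range (r + 1), ((dA * dB : ℝ) + i) with hN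
  have hA' : (0 : ℝ) < dA := by exact_mod_cast hA
  have hB' : (0 : ℝ) < dB := by exact_mod_cast hB
  have hNle : ((dA : ℝ) * dB) ^ (r + 1) ≤ N := by
    rw [hN, ← Finset.card_range (r + 1), ← Finset.prod_const, Finset.card_range]
    refine Finset.prod_le_prod (fun i _ => by positivity) fun i _ => ?_
    have : (0 : ℝ) ≤ i := by positivity
    linarith
  have hNC : (N : ℂ) = ∏ i ∈ Finset.range (r + 1), ((dA * dB : ℂ) + i) := by
    rw [hN]
    push_cast
    rfl
  have h3 : N * I.re = colouringConv (Fin dB) (Fin dA) (finRotate (r + 1)) := by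
    rw [← hNC] at h1
    have := congrArg Complex.re h1
    rwa [Complex.re_ofReal_mul, Complex.ofReal_re] at this
  have hNpos : 0 < N := lt_of_lt_of_le (by positivity) hNle
  have hI : 0 ≤ I.re := by
    have h0 : 0 ≤ N * I.re := by
      rw [h3]
      exact Finset.sum_nonneg fun σ _ => by positivity
    exact (mul_nonneg_iff_of_pos_left hNpos).1 h0
  have hBk : (0 : ℝ) < (dB : ℝ) ^ (r + 1) := by positivity
  refine le_of_mul_le_mul_left ?_ hBk
  calc (dB : ℝ) ^ (r + 1) * ((dA : ℝ) ^ (r + 1) * I.re) = ((dA : ℝ) * dB) ^ (r + 1) * I.re := by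
        rw [mul_pow]; ring
    _ ≤ N * I.re := by gcongr
    _ ≤ 4 ^ (r + 1) * dA * (dB : ℝ) ^ (r + 1) := by rw [h3]; exact h2
    _ = _ := by ring

/-! ### Spectrum and entropies of the reduced state -/

open scoped Matrix.Norms.L2Operator in
/-- The operator norm of a Hermitian matrix is the largest absolute value of its eigenvalues. -/
lemma norm_toEuclideanCLM_eq_norm_eigenvalues {n : ℕ} {A : Matrix (Fin n) (Fin n) ℂ}
    (hA : A.IsHermitian) :
    ‖Matrix.toEuclideanCLM (n := Fin n) (𝕜 := ℂ) A‖ = ‖hA.eigenvalues‖ := by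
  rw [Matrix.l2_opNorm_toEuclideanCLM]
  conv_lhs => rw [hA.spectral_theorem]
  rw [Unitary.conjStarAlgAut_apply, CStarRing.norm_mul_mem_unitary _ (Unitary.star_mem
    hA.eigenvectorUnitary.2), CStarRing.norm_mem_unitary_mul _ hA.eigenvectorUnitary.2,
    Matrix.l2_opNorm_diagonal]
  simp only [Pi.norm_def, Function.comp_apply]
  congr 2
  ext i
  simp

lemma trace_cfc_eq_sum {n : ℕ} {A : Matrix (Fin n) (Fin n) ℂ} (hA : A.IsHermitian) (f : ℝ → ℝ) :
    (cfc f A).trace = ∑ i, (f (hA.eigenvalues i) : ℂ) := by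
  rw [hA.cfc_eq, Matrix.IsHermitian.cfc, Unitary.conjStarAlgAut_apply, Matrix.trace_mul_comm,
    ← mul_assoc]
  simp [Matrix.trace_diagonal]

section Reduced

variable {dA dB : ℕ}

open scoped ComplexOrder in
lemma posSemidef_reducedDensity (ψ : BipartiteSpace dA dB) : (reducedDensity ψ).PosSemidef := by
  have : reducedDensity ψ = (Matrix.of fun i k => ψ (i, k)) *
      (Matrix.of fun i k => ψ (i, k) : Matrix (Fin dA) (Fin dB) ℂ).conjTranspose := by
    ext i j
    simp [reducedDensity, partialTraceB, ketBra, Matrix.mul_apply]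
  rw [this]
  exact Matrix.posSemidef_self_mul_conjTranspose _

lemma trace_reducedDensity {ψ : BipartiteSpace dA dB} (hψ : ‖ψ‖ = 1) :
    (reducedDensity ψ).trace = 1 := by
  have h := EuclideanSpace.norm_sq_eq ψ
  rw [hψ, Fintype.sum_prod_type] at h
  have e : ∀ i j, ψ (i, j) * star (ψ (i, j)) = ((‖ψ (i, j)‖ ^ 2 : ℝ) : ℂ) := by
    intro i j
    rw [Complex.star_def, Complex.mul_conj, Complex.normSq_eq_norm_sq]
  simp only [Matrix.trace, Matrix.diag_apply, reducedDensity, partialTraceB, ketBra,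
    Matrix.of_apply, e]
  exact_mod_cast (by linarith : ∑ i, ∑ j, ‖ψ (i, j)‖ ^ 2 = (1 : ℝ))

open scoped ComplexOrder in
/-- The spectral data of a reduced state. -/
lemma exists_eigenvalues_reducedDensity {ψ : BipartiteSpace dA dB} (hψ : ‖ψ‖ = 1) :
    ∃ l : Fin dA → ℝ, (∀ i, 0 ≤ l i) ∧ ∑ i, l i = 1 ∧
      (∃ i, ‖Matrix.toEuclideanCLM (n := Fin dA) (𝕜 := ℂ) (reducedDensity ψ)‖ = l i) ∧
      (∀ i, l i ≤ ‖Matrix.toEuclideanCLM (n := Fin dA) (𝕜 := ℂ) (reducedDensity ψ)‖) ∧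
      (∀ f : ℝ → ℝ, (cfc f (reducedDensity ψ)).trace.re = ∑ i, f (l i)) ∧
      ∀ k : ℕ, (reducedDensity ψ ^ k).trace.re = ∑ i, l i ^ k := by
  have hP := posSemidef_reducedDensity ψ
  have hH := hP.isHermitian
  have hcfc : ∀ f : ℝ → ℝ, (cfc f (reducedDensity ψ)).trace.re = ∑ i, f (hH.eigenvalues i) := by
    intro f
    rw [trace_cfc_eq_sum hH, ← Complex.ofReal_sum, Complex.ofReal_re]
  have hpow : ∀ k : ℕ, (reducedDensity ψ ^ k).trace.re = ∑ i, hH.eigenvalues i ^ k := by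
    intro k
    rw [← hcfc fun x => x ^ k, cfc_pow_id (R := ℝ) _ _ hH.isSelfAdjoint]
  have hsum : ∑ i, hH.eigenvalues i = 1 := by
    have := hpow 1
    rw [pow_one, trace_reducedDensity hψ] at this
    simpa using this.symm
  have h0 : ∀ i, 0 ≤ hH.eigenvalues i := hP.eigenvalues_nonneg
  rw [norm_toEuclideanCLM_eq_norm_eigenvalues hH]
  refine ⟨hH.eigenvalues, h0, hsum, ?_, ?_, hcfc, hpow⟩
  · have hne : Nonempty (Fin dA) := by
      by_contra hne
      rw [not_nonempty_iff] at hne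
      rw [Finset.univ_eq_empty, Finset.sum_empty] at hsum
      exact zero_ne_one hsum
    obtain ⟨i, -, hi⟩ := Finset.exists_max_image Finset.univ hH.eigenvalues Finset.univ_nonempty
    refine ⟨i, le_antisymm ?_ ?_⟩
    · rw [pi_norm_le_iff_of_nonneg (h0 i)]
      intro j
      rw [Real.norm_of_nonneg (h0 j)]
      exact hi j (Finset.mem_univ j)
    · exact (Real.le_norm_self _).trans (norm_le_pi_norm _ i)
  · exact fun i => (Real.le_norm_self _).trans (norm_le_pi_norm _ i)

lemma norm_reducedDensity_pos {ψ : BipartiteSpace dA dB} (hψ : ‖ψ‖ = 1) :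
    0 < ‖Matrix.toEuclideanCLM (n := Fin dA) (𝕜 := ℂ) (reducedDensity ψ)‖ := by
  obtain ⟨l, h0, h1, -, hle, -, -⟩ := exists_eigenvalues_reducedDensity hψ
  obtain ⟨i, -, hi⟩ : ∃ i ∈ Finset.univ, 0 < l i := by
    by_contra hcon
    push Not at hcon
    have := Finset.sum_nonpos hcon
    linarith
  exact hi.trans_le (hle i)

lemma norm_reducedDensity_le_one {ψ : BipartiteSpace dA dB} (hψ : ‖ψ‖ = 1) :
    ‖Matrix.toEuclideanCLM (n := Fin dA) (𝕜 := ℂ) (reducedDensity ψ)‖ ≤ 1 := by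
  obtain ⟨l, h0, h1, ⟨i, hi⟩, -, -, -⟩ := exists_eigenvalues_reducedDensity hψ
  rw [hi, ← h1]
  exact Finset.single_le_sum (fun j _ => h0 j) (Finset.mem_univ i)

lemma minEntropy_nonneg {ψ : BipartiteSpace dA dB} (hψ : ‖ψ‖ = 1) :
    0 ≤ minEntropy (reducedDensity ψ) := by
  have := Real.logb_nonpos (b := 2) (by norm_num) (norm_nonneg _) (norm_reducedDensity_le_one hψ)
  unfold minEntropy
  linarith

/-- All Rényi entropies of positive order dominate the min entropy. -/
lemma minEntropy_le_renyiEntropy {ψ : BipartiteSpace dA dB} (hψ : ‖ψ‖ = 1) (β : ℝ) :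
    minEntropy (reducedDensity ψ) ≤ renyiEntropy β (reducedDensity ψ) := by
  obtain ⟨l, h0, h1, ⟨i₀, hi₀⟩, hle, hcfc, -⟩ := exists_eigenvalues_reducedDensity hψ
  have hM := norm_reducedDensity_pos hψ
  unfold minEntropy renyiEntropy
  set M := ‖Matrix.toEuclideanCLM (n := Fin dA) (𝕜 := ℂ) (reducedDensity ψ)‖ with hMdef
  split_ifs with h
  · rw [hcfc, neg_le_neg_iff]
    calc ∑ i, l i * Real.logb 2 (l i) ≤ ∑ i, l i * Real.logb 2 M := by
          refine Finset.sum_le_sum fun i _ => ?_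
          rcases (h0 i).eq_or_lt with h2 | h2
          · simp [← h2]
          · exact mul_le_mul_of_nonneg_left
              (Real.logb_le_logb_of_le (by norm_num) h2 (hle i)) (h0 i)
      _ = Real.logb 2 M := by rw [← Finset.sum_mul, h1, one_mul]
  · rw [hcfc]
    have hpos : 0 < ∑ i, l i ^ β := by
      refine Finset.sum_pos' (fun i _ => Real.rpow_nonneg (h0 i) β) ⟨i₀, Finset.mem_univ _, ?_⟩
      rw [← hi₀]
      exact Real.rpow_pos_of_pos hM β
    have hlog : Real.logb 2 (M ^ (β - 1)) = (β - 1) * Real.logb 2 M := Real.logb_rpow_eq_mul_logb_of_pos hM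
    have hM1 : ∑ i, l i * M ^ (β - 1) = M ^ (β - 1) := by rw [← Finset.sum_mul, h1, one_mul]
    have hsplit : ∀ i, 0 < l i → l i ^ β = l i * l i ^ (β - 1) := by
      intro i hi
      rw [Real.rpow_sub_one hi.ne']
      field_simp
    -- Since `∑ l i ^ β = ∑ l i * l i ^ (β - 1)` averages powers of numbers at most `M`, it is
    -- compared with `M ^ (β - 1)`. The direction changes with the sign of `β - 1`, and so does that
    -- of the prefactor `1 / (1 - β)`.
    rcases lt_or_gt_of_ne h with hlt | hgt
    · have hge : M ^ (β - 1) ≤ ∑ i, l i ^ β := by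
        rw [← hM1]
        refine Finset.sum_le_sum fun i _ => ?_
        rcases (h0 i).eq_or_lt with h2 | h2
        · rw [← h2, zero_mul]
          exact Real.rpow_nonneg le_rfl _
        · rw [hsplit i h2]
          exact mul_le_mul_of_nonneg_left
            (Real.rpow_le_rpow_of_nonpos h2 (hle i) (by linarith)) (h0 i)
      have h3 := Real.logb_le_logb_of_le (b := 2) (by norm_num) (by positivity) hge
      rw [hlog] at h3
      rw [div_mul_eq_mul_div, one_mul, le_div_iff₀ (by linarith)]
      linarith
    · have hge : ∑ i, l i ^ β ≤ M ^ (β - 1) := by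
        rw [← hM1]
        refine Finset.sum_le_sum fun i _ => ?_
        rcases (h0 i).eq_or_lt with h2 | h2
        · rw [← h2, zero_mul, Real.zero_rpow (by linarith)]
        · rw [hsplit i h2]
          exact mul_le_mul_of_nonneg_left
            (Real.rpow_le_rpow (h0 i) (hle i) (by linarith)) (h0 i)
      have h3 := Real.logb_le_logb_of_le (b := 2) (by norm_num) hpos hge
      rw [hlog] at h3
      rw [div_mul_eq_mul_div, one_mul, le_div_iff_of_neg (by linarith)]
      linarith

lemma continuous_reducedDensity :
    Continuous fun ψ : PureState (Fin dA × Fin dB) => reducedDensity ψ.1 := by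
  refine continuous_matrix fun i j => ?_
  simp only [reducedDensity, partialTraceB, ketBra, Matrix.of_apply]
  fun_prop

lemma continuous_minEntropy_reducedDensity :
    Continuous fun ψ : PureState (Fin dA × Fin dB) => minEntropy (reducedDensity ψ.1) := by
  have h1 : Continuous (Matrix.toEuclideanCLM (n := Fin dA) (𝕜 := ℂ)) :=
    LinearMap.continuous_of_finiteDimensional
      ((Matrix.toEuclideanCLM (n := Fin dA) (𝕜 := ℂ)).toAlgEquiv.toLinearMap)
  unfold minEntropy
  have h2 : Continuous fun ψ : PureState (Fin dA × Fin dB) =>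
      ‖Matrix.toEuclideanCLM (n := Fin dA) (𝕜 := ℂ) (reducedDensity ψ.1)‖ :=
    (h1.comp continuous_reducedDensity).norm
  refine (h2.logb fun ψ => ?_).neg
  exact (norm_reducedDensity_pos (mem_sphere_zero_iff_norm.1 ψ.2)).ne'

/-- The eigenvalues lie in `[0, 1]`, so by Weierstrass the trace is a uniform limit of combinations
of the continuous functions `tr ρ ^ j`. -/
lemma continuous_trace_cfc_reducedDensity {f : ℝ → ℝ} (hf : ContinuousOn f (Set.Icc 0 1)) :
    Continuous fun ψ : PureState (Fin dA × Fin dB) => (cfc f (reducedDensity ψ.1)).trace.re := by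
  refine continuous_of_uniform_approx_of_continuous fun u hu => ?_
  obtain ⟨ε, hε, hεu⟩ := Metric.mem_uniformity_dist.1 hu
  obtain ⟨p, hp⟩ := exists_polynomial_near_of_continuousOn 0 1 f hf (ε / (dA + 1)) (by positivity)
  refine ⟨fun ψ => ∑ j ∈ Finset.range (p.natDegree + 1),
    p.coeff j * (reducedDensity ψ.1 ^ j).trace.re, ?_, fun ψ => hεu ?_⟩
  · refine continuous_finsetSum _ fun j _ => continuous_const.mul ?_
    exact Complex.continuous_re.comp ((continuous_reducedDensity.pow j).matrix_trace)
  · obtain ⟨l, h0, h1, -, -, hcfc, hpow⟩ :=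
      exists_eigenvalues_reducedDensity (mem_sphere_zero_iff_norm.1 ψ.2)
    have hl1 : ∀ i, l i ≤ 1 := fun i => by
      rw [← h1]
      exact Finset.single_le_sum (fun j _ => h0 j) (Finset.mem_univ i)
    have e : ∑ j ∈ Finset.range (p.natDegree + 1), p.coeff j * (reducedDensity ψ.1 ^ j).trace.re =
        ∑ i, p.eval (l i) := by
      simp only [hpow, Finset.mul_sum, Polynomial.eval_eq_sum_range]
      rw [Finset.sum_comm]
    simp only [e]
    rw [hcfc, Real.dist_eq, ← Finset.sum_sub_distrib]
    calc |∑ i, (f (l i) - p.eval (l i))| ≤ ∑ i, |f (l i) - p.eval (l i)| :=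
          Finset.abs_sum_le_sum_abs _ _
      _ ≤ ∑ _i : Fin dA, ε / (dA + 1) := by
          refine Finset.sum_le_sum fun i _ => ?_
          rw [abs_sub_comm]
          exact (hp (l i) ⟨h0 i, hl1 i⟩).le
      _ = dA * (ε / (dA + 1)) := by simp
      _ < ε := by
          rw [mul_div_assoc', div_lt_iff₀ (by positivity)]
          nlinarith

lemma continuous_renyiEntropy_reducedDensity {β : ℝ} (hβ : 0 < β) :
    Continuous fun ψ : PureState (Fin dA × Fin dB) => renyiEntropy β (reducedDensity ψ.1) := by
  unfold renyiEntropy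
  split_ifs with h
  · refine (continuous_trace_cfc_reducedDensity ?_).neg
    have : (fun x : ℝ => x * Real.logb 2 x) = fun x => x * Real.log x / Real.log 2 := by
      ext x
      rw [Real.logb, mul_div_assoc]
    rw [this]
    exact (Real.continuous_mul_log.div_const _).continuousOn
  · have hc : Continuous fun x : ℝ => x ^ β :=
      Real.continuous_rpow_const hβ.le
    refine continuous_const.mul ((continuous_trace_cfc_reducedDensity hc.continuousOn).logb ?_)
    intro ψ
    have hψ := mem_sphere_zero_iff_norm.1 ψ.2
    obtain ⟨l, h0, h1, ⟨i₀, hi₀⟩, hle, hcfc, -⟩ := exists_eigenvalues_reducedDensity hψ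
    rw [hcfc]
    refine (Finset.sum_pos' (fun i _ => Real.rpow_nonneg (h0 i) β) ⟨i₀, Finset.mem_univ _, ?_⟩).ne'
    rw [← hi₀]
    exact Real.rpow_pos_of_pos (norm_reducedDensity_pos hψ) β

/-- A linear lower bound for the min entropy in terms of the trace of a power. -/
lemma minEntropy_ge {ψ : BipartiteSpace dA dB} (hψ : ‖ψ‖ = 1) (r : ℕ) {c : ℝ} (hc : 0 < c) :
    -(Real.logb 2 c + ((reducedDensity ψ ^ (r + 1)).trace.re / c - 1) / Real.log 2) / (r + 1) ≤
      minEntropy (reducedDensity ψ) := by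
  obtain ⟨l, h0, h1, ⟨i₀, hi₀⟩, hle, -, hpow⟩ := exists_eigenvalues_reducedDensity hψ
  have hM := norm_reducedDensity_pos hψ
  unfold minEntropy
  set M := ‖Matrix.toEuclideanCLM (n := Fin dA) (𝕜 := ℂ) (reducedDensity ψ)‖ with hMdef
  rw [hpow]
  have h2 : M ^ (r + 1) ≤ ∑ i, l i ^ (r + 1) := by
    rw [hi₀]
    exact Finset.single_le_sum (f := fun i => l i ^ (r + 1))
      (fun i _ => pow_nonneg (h0 i) _) (Finset.mem_univ i₀)
  set t := ∑ i, l i ^ (r + 1)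
  have ht : 0 < t := lt_of_lt_of_le (by positivity) h2
  have hlog2 : 0 < Real.log 2 := Real.log_pos (by norm_num)
  have h3 : (r + 1) * Real.log M ≤ Real.log t := by
    have := Real.log_le_log (by positivity) h2
    rwa [Real.log_pow, Nat.cast_add_one] at this
  -- The tangent to the logarithm at `c` replaces Jensen's inequality: the bound becomes affine in
  -- the trace and can be integrated directly.
  have h4 : Real.log t - Real.log c ≤ t / c - 1 := by
    rw [← Real.log_div ht.ne' hc.ne']
    exact Real.log_le_sub_one_of_pos (by positivity)
  rw [neg_div, neg_le_neg_iff, le_div_iff₀ (by positivity), Real.logb, Real.logb, ← add_div,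
    div_mul_eq_mul_div]
  gcongr
  linarith

end Reduced

/-! ### The averaged entropy bounds -/

/-- Writing the ceiling as `k + 1` gives `2 ^ k < d ≤ n`, and `(k + 1) ^ 3 ≤ 16 * 4 ^ k`. Hence the
size condition is automatic for `a = 1`. -/
lemma ceil_logb_cube_le {d n : ℕ} (hd : 0 < d) (hdn : d ≤ n) :
    ((⌈Real.logb 2 d⌉₊ : ℕ) : ℝ) ^ 3 ≤ 16 * (n : ℝ) ^ 2 := by
  have hcube : ∀ k : ℕ, (k + 1) ^ 3 ≤ 16 * 4 ^ k := by
    intro k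
    induction k with
    | zero => norm_num
    | succ k ih =>
      rcases k with _ | k
      · norm_num
      · rw [pow_succ 4 (k + 1)]
        nlinarith [Nat.zero_le (k ^ 3), Nat.zero_le (k ^ 2)]
  rcases hk : ⌈Real.logb 2 d⌉₊ with _ | k
  · simp
  · have h1 : (k : ℝ) < Real.logb 2 d := by
      rw [← Nat.lt_ceil, hk]
      exact Nat.lt_succ_self k
    have hd' : (0 : ℝ) < d := by exact_mod_cast hd
    have h2 : (2 : ℝ) ^ k < d := by
      rw [Real.lt_logb_iff_rpow_lt (by norm_num) hd', Real.rpow_natCast] at h1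
      exact h1
    have h3 : (2 : ℝ) ^ k ≤ n := h2.le.trans (by exact_mod_cast hdn)
    calc ((k + 1 : ℕ) : ℝ) ^ 3 ≤ 16 * 4 ^ k := by exact_mod_cast hcube k
      _ = 16 * (2 ^ k) ^ 2 := by rw [← pow_mul, mul_comm k 2, pow_mul]; norm_num
      _ ≤ 16 * (n : ℝ) ^ 2 := by gcongr

/-- The lower bound on the average min entropy of a design. -/
lemma integral_minEntropy_ge {dA dB : ℕ} (hA : 0 < dA) (hAB : dA ≤ dB) {k : ℕ}
    (ν : Measure (PureState (Fin dA × Fin dB))) (hν : IsProjectiveDesign k ν) {a : ℝ} (ha : 0 < a)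
    (hk : Real.logb 2 dA / a ≤ k) (hk3 : (k : ℝ) ^ 3 ≤ 16 * (dB : ℝ) ^ 2) :
    Real.logb 2 dA - 2 - a ≤ ∫ ψ, minEntropy (reducedDensity ψ.1) ∂ν := by
  have := hν.1
  have hA' : (0 : ℝ) < dA := by exact_mod_cast hA
  rcases k with _ | r
  -- In degree `0` the design carries no information, but then `log dA ≤ 0` and nonnegativity of the
  -- entropy suffices.
  · have hlog : Real.logb 2 dA ≤ 0 := by
      rw [div_le_iff₀ ha] at hk
      simpa using hk
    have : 0 ≤ ∫ ψ, minEntropy (reducedDensity ψ.1) ∂ν :=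
      integral_nonneg fun ψ => minEntropy_nonneg (mem_sphere_zero_iff_norm.1 ψ.2)
    linarith
  · push_cast at hk hk3
    have hm := pow_mul_integral_trace_le hA hAB r ν hν hk3
    -- The tangent point is the moment bound itself, so the linear correction has nonpositive mean
    -- and can be dropped.
    set c : ℝ := 4 ^ (r + 1) * dA / (dA : ℝ) ^ (r + 1) with hc
    have hcpos : 0 < c := by positivity
    have hcont : Continuous fun ψ : PureState (Fin dA × Fin dB) =>
        (reducedDensity ψ.1 ^ (r + 1)).trace.re :=
      Complex.continuous_re.comp ((continuous_reducedDensity.pow _).matrix_trace)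
    have hint := integrable_of_continuous_sphere ν hcont
    have hint' : Integrable (fun ψ : PureState (Fin dA × Fin dB) =>
        ((reducedDensity ψ.1 ^ (r + 1)).trace.re / c - 1) / Real.log 2) ν :=
      ((hint.div_const _).sub (integrable_const _)).div_const _
    have hmono : ∫ ψ, -(Real.logb 2 c + ((reducedDensity ψ.1 ^ (r + 1)).trace.re / c - 1) /
        Real.log 2) / (r + 1) ∂ν ≤ ∫ ψ, minEntropy (reducedDensity ψ.1) ∂ν := by
      refine integral_mono ?_ (integrable_of_continuous_sphere ν continuous_minEntropy_reducedDensity)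
        fun ψ => minEntropy_ge (mem_sphere_zero_iff_norm.1 ψ.2) r hcpos
      exact (((integrable_const _).add hint').neg).div_const _
    refine le_trans ?_ hmono
    rw [integral_div, integral_neg, integral_add (integrable_const _) hint', integral_div,
      integral_sub (hint.div_const _) (integrable_const _), integral_div]
    simp only [integral_const, probReal_univ, one_smul]
    set I := ∫ ψ, (reducedDensity ψ.1 ^ (r + 1)).trace.re ∂ν
    have hI : I / c ≤ 1 := by
      rw [div_le_one hcpos, hc, le_div_iff₀ (by positivity)]
      linarith
    have hlog2 : 0 < Real.log 2 := Real.log_pos (by norm_num)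
    have hI2 : (I / c - 1) / Real.log 2 ≤ 0 := div_nonpos_of_nonpos_of_nonneg (by linarith) hlog2.le
    have hlogc : Real.logb 2 c = 2 * (r + 1) - r * Real.logb 2 dA := by
      rw [hc, Real.logb_div (by positivity) (by positivity), Real.logb_mul (by positivity) hA'.ne',
        Real.logb_pow, Real.logb_pow, show (4 : ℝ) = 2 ^ 2 by norm_num, Real.logb_pow,
        Real.logb_self_eq_one (by norm_num)]
      push_cast
      ring
    rw [le_div_iff₀ (by positivity), hlogc]
    rw [div_le_iff₀ ha] at hk
    nlinarith

theorem theorem3 (dA dB : ℕ) (hAB : dA ≤ dB) (α : ℕ)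
    (ν : Measure (PureState (Fin dA × Fin dB))) (hν : IsProjectiveDesign α ν) :
    Integrable (fun ψ => minEntropy (reducedDensity ψ.1)) ν ∧
    (∀ β : ℝ, 0 < β → Integrable (fun ψ => renyiEntropy β (reducedDensity ψ.1)) ν) ∧
    (∀ a : ℝ, 0 < a → a ≤ 1 → α = ⌈Real.logb 2 dA / a⌉₊ →
      (α : ℝ) ≤ (16 * (dB : ℝ) ^ 2) ^ (1 / 3 : ℝ) →
      Real.logb 2 dA - 2 - a ≤ ∫ ψ, minEntropy (reducedDensity ψ.1) ∂ν ∧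
      ∀ β : ℝ, 0 < β →
        Real.logb 2 dA - 2 - a ≤ ∫ ψ, renyiEntropy β (reducedDensity ψ.1) ∂ν) ∧
    (α = ⌈Real.logb 2 dA⌉₊ →
      Real.logb 2 dA - 3 ≤ ∫ ψ, minEntropy (reducedDensity ψ.1) ∂ν ∧
      ∀ β : ℝ, 0 < β →
        Real.logb 2 dA - 3 ≤ ∫ ψ, renyiEntropy β (reducedDensity ψ.1) ∂ν) := by
  have hprob := hν.1
  -- For `dA = 0` the unit sphere is empty and carries no probability measure.
  have hA : 0 < dA := by
    obtain ⟨ψ⟩ := nonempty_of_isProbabilityMeasure ν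
    by_contra h0
    obtain rfl : dA = 0 := by omega
    have h1 := mem_sphere_zero_iff_norm.1 ψ.2
    rw [Subsingleton.elim ψ.1 0, norm_zero] at h1
    exact zero_ne_one h1
  have hmin : Integrable (fun ψ => minEntropy (reducedDensity ψ.1)) ν :=
    integrable_of_continuous_sphere ν continuous_minEntropy_reducedDensity
  have hren : ∀ β : ℝ, 0 < β → Integrable (fun ψ => renyiEntropy β (reducedDensity ψ.1)) ν :=
    fun β hβ => integrable_of_continuous_sphere ν (continuous_renyiEntropy_reducedDensity hβ)
  have hle : ∀ β : ℝ, 0 < β → ∫ ψ, minEntropy (reducedDensity ψ.1) ∂ν ≤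
      ∫ ψ, renyiEntropy β (reducedDensity ψ.1) ∂ν := fun β hβ =>
    integral_mono hmin (hren β hβ) fun ψ =>
      minEntropy_le_renyiEntropy (mem_sphere_zero_iff_norm.1 ψ.2) β
  refine ⟨hmin, hren, fun a ha _ hα hα3 => ?_, fun hα => ?_⟩
  · have h3 : (α : ℝ) ^ 3 ≤ 16 * (dB : ℝ) ^ 2 := by
      have h := pow_le_pow_left₀ (Nat.cast_nonneg α) hα3 3
      rwa [← Real.rpow_natCast (_ ^ (1 / 3 : ℝ)), ← Real.rpow_mul (by positivity),
        show (1 / 3 : ℝ) * ((3 : ℕ) : ℝ) = 1 by norm_num, Real.rpow_one] at h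
    have hmain := integral_minEntropy_ge hA hAB ν hν ha (by rw [hα]; exact Nat.le_ceil _) h3
    exact ⟨hmain, fun β hβ => hmain.trans (hle β hβ)⟩
  · have hmain := integral_minEntropy_ge hA hAB ν hν one_pos
      (by rw [hα, div_one]; exact Nat.le_ceil _) (by rw [hα]; exact ceil_logb_cube_le hA hAB)
    have hmain' : Real.logb 2 dA - 3 ≤ ∫ ψ, minEntropy (reducedDensity ψ.1) ∂ν := by linarith
    exact ⟨hmain', fun β hβ => hmain'.trans (hle β hβ)⟩
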